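/- Let $\Bbbk$ be an algebraically closed field, let $n\ge 0$, let $w_0,\dots,w_n$ be positive integers, let $S(\mathbf w)=\Bbbk[x_0,\dots,x_n]$ be graded by $\deg x_i=w_i$, and let $\mathbf P(\mathbf w)=\operatorname{Proj} S(\mathbf w)$. Let $1\le p\le q$ and let $M=(M_{ij})$ be a $p\times q$ matrix with entries in $S(\mathbf w)$ whose ideal $I_p(M)$ of maximal ($p\times p$) minors is homogeneous (for instance, all $M_{ij}$ are homogeneous and $\deg M_{ij}-\deg M_{i'j}$ does not depend on $j$). Suppose that $M$ is pseudo $1$-generic: for every $0\ne c\in\Bbbk^p$ the entries $\sum_i c_iM_{i1},\dots,\sum_i c_iM_{iq}$ of the corresponding generalized row form a regular sequence in the local ring $S(\mathbf w)_{(x_0,\dots,x_n)}$. Then the scheme $X=V(I_p(M))\subset\mathbf P(\mathbf w)$ defined by $I_p(M)$ is arithmetically Cohen–Macaulay, i.e. its coordinate ring $S(\mathbf w)/I_p(M)$ is a Cohen–Macaulay ring, and it has codimension $q-p+1$: the ideal $I_p(M)$ has height $q-p+1$, and $X$ has codimension $q-p+1$ in $\mathbf P(\mathbf w)$ if $q-p+1\le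 n$, and is empty if $q-p+1>n$. -/

import Mathlib

namespace WeightedDet

/-! ### Cohen–Macaulay rings -/

section CohenMacaulay

/-- The depth of a Noetherian local ring: the supremum of the lengths of its regular sequences.
(`IsRegular R rs` contains the condition `(rs) ≠ R`, so that, in a local ring, the members of a
regular sequence lie in the maximal ideal.) -/
noncomputable def depth (R : Type*) [CommRing R] : ℕ∞ :=
  ⨆ rs : {rs : List R // RingTheory.Sequence.IsRegular R rs}, (rs.1.length : ℕ∞)

/-- A Noetherian ring is Cohen–Macaulay if for each maximal ideal `𝔪` the local ring `R_𝔪`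
satisfies `depth R_𝔪 = dim R_𝔪`. -/
structure IsCohenMacaulayRing (R : Type*) [CommRing R] : Prop where
  isNoetherianRing : IsNoetherianRing R
  depth_eq_dim : ∀ (𝔪 : Ideal R) [𝔪.IsMaximal],
    (depth (Localization.AtPrime 𝔪) : WithBot ℕ∞) = ringKrullDim (Localization.AtPrime 𝔪)

end CohenMacaulay

/-- The codimension of a subset `Z` (in practice a closed one) of a topological space `T`: the
infimum, over the irreducible closed subsets `Y ⊆ Z`, of the supremum of the lengths of chains
`Y = Y₀ ⊂ Y₁ ⊂ ⋯ ⊂ Y_c` of irreducible closed subsets of `T`. -/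
noncomputable def codim {T : Type*} [TopologicalSpace T] (Z : Set T) : ℕ∞ :=
  ⨅ (Y : TopologicalSpace.IrreducibleCloseds T) (_ : (Y : Set T) ⊆ Z), Order.coheight Y

/-! ### The weighted polynomial ring and weighted projective space -/

section WeightedProjectiveSpace

variable (k : Type*) [Field k] {n : ℕ}

/-- The grading by `deg x_i = w i` of the polynomial ring `S(w) = k[x_0, …, x_n]`. -/
noncomputable abbrev grading (w : Fin (n + 1) → ℕ) :
    ℕ → Submodule k (MvPolynomial (Fin (n + 1)) k) :=
  MvPolynomial.weightedHomogeneousSubmodule k w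

noncomputable instance gradedAlgebra (w : Fin (n + 1) → ℕ) : GradedAlgebra (grading k w) :=
  MvPolynomial.weightedGradedAlgebra k w

/-- Weighted projective space `P(w) = Proj S(w)`. -/
noncomputable def WeightedProj (w : Fin (n + 1) → ℕ) : AlgebraicGeometry.Scheme :=
  AlgebraicGeometry.Proj (grading k w)

/-- The closed subset `V(I)` of `P(w)`: the relevant homogeneous primes that contain `I`. -/
def vanishingLocus (w : Fin (n + 1) → ℕ) (I : Ideal (MvPolynomial (Fin (n + 1)) k)) :
    Set (WeightedProj k w) :=
  ProjectiveSpectrum.zeroLocus (grading k w) I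

end WeightedProjectiveSpace

/-! ### Pseudo 1-generic matrices and ideals of maximal minors -/

section Matrices

variable {k : Type*} [Field k] {n : ℕ}

/-- The ideal `(x_0, …, x_n)` is prime. -/
instance isPrime_idealOfVars : (MvPolynomial.idealOfVars (Fin (n + 1)) k).IsPrime := by
  have h : MvPolynomial.idealOfVars (Fin (n + 1)) k =
      RingHom.ker (MvPolynomial.constantCoeff (σ := Fin (n + 1)) (R := k)) := by
    ext f
    have h1 := MvPolynomial.mem_pow_idealOfVars_iff (σ := Fin (n + 1)) (R := k) 1 f
    rw [pow_one] at h1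
    rw [h1, RingHom.mem_ker, MvPolynomial.constantCoeff_eq]
    constructor
    · intro h
      by_contra hc
      have := h 0 (by simpa using hc)
      simp at this
    · intro h x hx
      rw [Nat.one_le_iff_ne_zero, Ne, Finsupp.degree_eq_zero_iff]
      rintro rfl
      simp [h] at hx
  rw [h]
  exact RingHom.ker_isPrime _

/-- The local ring `S(w)_{(x_0, …, x_n)}`. -/
abbrev LocalRingAtOrigin (k : Type*) [Field k] (n : ℕ) : Type _ :=
  Localization.AtPrime (MvPolynomial.idealOfVars (Fin (n + 1)) k)

variable {p q : ℕ}

/-- The linear combination of the rows of `M` with coefficients `c`. For `c ≠ 0` this is a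
generalized row of `M`. -/
noncomputable def generalizedRow (M : Matrix (Fin p) (Fin q) (MvPolynomial (Fin (n + 1)) k))
    (c : Fin p → k) : Fin q → MvPolynomial (Fin (n + 1)) k :=
  fun j => ∑ i, MvPolynomial.C (c i) * M i j

/-- `M` is pseudo 1-generic if the entries of each generalized row form a regular sequence in
`S(w)_{(x_0, …, x_n)}`. -/
def IsPseudoOneGeneric (M : Matrix (Fin p) (Fin q) (MvPolynomial (Fin (n + 1)) k)) : Prop :=
  ∀ c : Fin p → k, c ≠ 0 →
    RingTheory.Sequence.IsRegular (LocalRingAtOrigin k n)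
      (List.ofFn fun j => algebraMap _ (LocalRingAtOrigin k n) (generalizedRow M c j))

/-- The ideal `I_p(M)` generated by the `p × p` minors of a `p × q` matrix: one minor for each
choice of `p` columns. -/
noncomputable def maximalMinors {A : Type*} [CommRing A] (M : Matrix (Fin p) (Fin q) A) :
    Ideal A :=
  Ideal.span (Set.range fun f : Fin p ↪o Fin q => (M.submatrix id f).det)

end Matrices

end WeightedDet

/-! Write `S` for the polynomial ring, `𝔪` for the ideal of the origin, `I` for the ideal of maximal
minors and `e = q - p + 1`. Two bounds carry the theorem: primes over `I` have height at least `e`,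
and the local rings of `S/I` at maximal ideals have depth at least `n + 1 - e`. The first bounds the
dimension of these local rings by `n + 1 - e`, so depth and dimension agree. Conversely, the depth
bound at the origin forces a prime over `I` of height at most `e`.

Height (`le_height_of_isPseudoOneGeneric`). Let `P ≤ 𝔪` be a prime containing the minors. Over
`Frac(S/P)` the rows are dependent. In a valuation ring dominating `(S/P)_𝔪` the relation can be
scaled to have integral coefficients, one of them `1`, so it specialises over the origin to some `c₀
≠ 0` in `k^p`. The closure of the graph of the relation lies in `A^p × A^(n+1)`, has the dimension
of `V(P)`, and lies in a hyperplane `y_{i₀} = 1`. Its fibre over `c₀` lies in the zero locus of the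
generalized row of `c₀`, of dimension `n + 1 - q` at the origin by pseudo 1-genericity. Hence `dim
V(P) ≤ (n + 1 - q) + (p - 1)`.

Depth (`depthGE_quotient_leadingMinors`). Let `C(p,q)` be the cokernel and `I(p,q)` the ideal of
maximal minors of the leading `p × q` block. An induction on blocks uses the exact sequences `0 →
R/I(p+1,q) → C(p+1,q) → C(p,q) → 0` (kill the last unit vector) and `0 → R/I(p,q) → C(p,q) →
C(p,q+1) → 0` (kill the next column). Injectivity on the left rests on Cramer's rule and on the
height bounds, which prevent `I(p,q+1)` from lying in an associated prime of `R/I(p,q)`.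

Globalisation. Minors of smaller blocks need not be homogeneous, so their height bounds are known
only on an open set `F ≠ 0` containing the origin. Since `I` is homogeneous, the torus acts on
`S/I`; it moves every closed point into that open set. For `I` itself, minimal primes are
homogeneous, hence contained in `𝔪`. Finally `height_projectiveSpectrum` identifies codimension in
`Proj` with height. -/

namespace WeightedDet

open CategoryTheory Abelian IsLocalRing
open scoped Pointwise

universe u

/-! ### Depth over a local ring through vanishing of Ext -/

section Depth

variable {R : Type u} [CommRing R] {L M N : Type u} [AddCommGroup L] [AddCommGroup M]
  [AddCommGroup N] [Module R L] [Module R M] [Module R N]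

/-- The short complex attached to two composable linear maps that form an exact sequence. -/
def linearShortComplex {f : L →ₗ[R] M} {g : M →ₗ[R] N} (hfg : Function.Exact f g) :
    ShortComplex (ModuleCat.{u} R) :=
  ShortComplex.mk (ModuleCat.ofHom f) (ModuleCat.ofHom g) (by
    ext x
    exact hfg.apply_apply_eq_zero x)

theorem linearShortComplex_shortExact {f : L →ₗ[R] M} {g : M →ₗ[R] N}
    (hfg : Function.Exact f g) (hf : Function.Injective f) (hg : Function.Surjective g) :
    (linearShortComplex hfg).ShortExact :=
  ModuleCat.shortComplex_shortExact _ hfg hf hg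

theorem exact_smul_quotSMulTop (x : R) :
    Function.Exact (LinearMap.lsmul R M x) (Submodule.mkQ (x • (⊤ : Submodule R M))) :=
  LinearMap.exact_lsmul_mkQ_smul_top M x

/-- Prime avoidance: the zero divisors on `M` form the union of the finitely many associated primes.
-/
theorem exists_isSMulRegular_mem [IsNoetherianRing R] [Module.Finite R M] (I : Ideal R)
    (hI : ∀ P, IsAssociatedPrime P M → ¬ I ≤ P) : ∃ x ∈ I, IsSMulRegular M x := by
  have h1 := (I.subset_union_prime_finite (associatedPrimes.finite R M) (f := id) 0 0
    (fun _ h _ _ => h.1)).not.mpr (by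
      rintro ⟨P, hP, hle⟩
      exact hI P hP hle)
  obtain ⟨x, hxI, hx⟩ := Set.not_subset.mp h1
  refine ⟨x, hxI, ?_⟩
  rw [isSMulRegular_iff_right_eq_zero_of_smul]
  intro m hm
  by_contra hne
  apply hx
  have h2 := biUnion_associatedPrimes_eq_zero_divisors R M
  simp only [id]
  rw [h2]
  exact ⟨m, hne, hm⟩

variable (R) [IsLocalRing R]

/-- The module `M` over the local ring `R` has depth at least `d`, expressed by the vanishing of
`Ext^i(κ, M)` for `i < d`, where `κ` is the residue field of `R`. -/
def DepthGE (d : ℕ) (M : Type u) [AddCommGroup M] [Module R M] : Prop :=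
  ∀ i < d, ∀ x : Ext (ModuleCat.of R (ResidueField R)) (ModuleCat.of R M) i, x = 0

variable {R}

theorem DepthGE.mono {d e : ℕ} (h : DepthGE R d M) (hde : e ≤ d) : DepthGE R e M :=
  fun i hi => h i (by omega)

theorem depthGE_zero : DepthGE R 0 M := fun i hi => by omega

theorem DepthGE.of_exact_left {d : ℕ} {f : L →ₗ[R] M} {g : M →ₗ[R] N}
    (hfg : Function.Exact f g) (hf : Function.Injective f) (hg : Function.Surjective g)
    (hM : DepthGE R (d + 1) M) (hN : DepthGE R d N) : DepthGE R (d + 1) L := by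
  have hS := linearShortComplex_shortExact hfg hf hg
  intro i hi x
  cases i with
  | zero =>
    apply Ext.postcomp_mk₀_injective_of_mono _ (linearShortComplex hfg).f (hf := hS.mono_f)
    exact (hM 0 (by omega) _).trans (map_zero _).symm
  | succ i =>
    obtain ⟨y, rfl⟩ := Ext.covariant_sequence_exact₁ _ hS x (hM _ hi _) rfl
    have : y = 0 := hN i (by omega) y
    rw [this, Ext.zero_comp]
    rfl

theorem DepthGE.of_exact_right {d : ℕ} {f : L →ₗ[R] M} {g : M →ₗ[R] N}
    (hfg : Function.Exact f g) (hf : Function.Injective f) (hg : Function.Surjective g)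
    (hL : DepthGE R (d + 1) L) (hM : DepthGE R d M) : DepthGE R d N := by
  have hS := linearShortComplex_shortExact hfg hf hg
  intro i hi x
  obtain ⟨y, rfl⟩ := Ext.covariant_sequence_exact₃ _ hS x rfl (hL (i + 1) (by omega) _)
  have : y = 0 := hM i hi y
  rw [this, Ext.zero_comp]
  rfl

theorem DepthGE.of_exact_middle {d : ℕ} {f : L →ₗ[R] M} {g : M →ₗ[R] N}
    (hfg : Function.Exact f g) (hf : Function.Injective f) (hg : Function.Surjective g)
    (hL : DepthGE R d L) (hN : DepthGE R d N) : DepthGE R d M := by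
  have hS := linearShortComplex_shortExact hfg hf hg
  intro i hi x
  obtain ⟨y, rfl⟩ := Ext.covariant_sequence_exact₂ _ hS x (hN i hi _)
  have : y = 0 := hL i hi y
  rw [this, Ext.zero_comp]
  rfl

theorem DepthGE.of_subsingleton [Subsingleton M] (d : ℕ) : DepthGE R d M := by
  intro i _ x
  have h : 𝟙 (ModuleCat.of R M) = 0 := by
    ext y
    exact Subsingleton.elim _ _
  rw [← Ext.comp_mk₀_id x, h, Ext.mk₀_zero, Ext.comp_zero]

theorem DepthGE.congr {d : ℕ} (e : L ≃ₗ[R] M) (h : DepthGE R d L) : DepthGE R d M := by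
  intro i hi x
  have h1 : ModuleCat.ofHom e.symm.toLinearMap ≫ ModuleCat.ofHom e.toLinearMap =
      𝟙 (ModuleCat.of R M) := by
    ext y
    simp
  rw [← Ext.comp_mk₀_id x, ← h1, ← Ext.mk₀_comp_mk₀,
    ← Ext.comp_assoc_of_second_deg_zero]
  have h2 : x.comp (Ext.mk₀ (ModuleCat.ofHom e.symm.toLinearMap)) (add_zero i) = 0 := h i hi _
  rw [h2, Ext.zero_comp]

theorem depthGE_pi {d p : ℕ} (h : DepthGE R d M) : DepthGE R d (Fin p → M) := by
  induction p with
  | zero => exact .of_subsingleton d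
  | succ p ih =>
    let f : M →ₗ[R] (Fin (p + 1) → M) := LinearMap.single R (fun _ => M) 0
    let g : (Fin (p + 1) → M) →ₗ[R] (Fin p → M) := LinearMap.funLeft R M Fin.succ
    refine DepthGE.of_exact_middle (f := f) (g := g) ?_ ?_ ?_ h ih
    · intro v
      constructor
      · intro hv
        refine ⟨v 0, ?_⟩
        ext j
        refine Fin.cases ?_ (fun j => ?_) j
        · simp [f]
        · have := congrFun hv j
          simpa [f, g, LinearMap.funLeft_apply] using this.symm
      · rintro ⟨x, rfl⟩
        ext j
        simp [f, g, LinearMap.funLeft_apply]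
    · exact Pi.single_injective (M := fun _ => M) 0
    · exact LinearMap.funLeft_surjective_of_injective R M _ (Fin.succ_injective p)

theorem DepthGE.quotSMulTop {d : ℕ} {x : R} (h : DepthGE R (d + 1) M)
    (hx : IsSMulRegular M x) : DepthGE R d (QuotSMulTop x M) :=
  DepthGE.of_exact_right (exact_smul_quotSMulTop x) hx (Submodule.mkQ_surjective _) h
    (h.mono (by omega))

theorem ext_residueField_smul_eq_zero {i : ℕ} {x : R} (hx : x ∈ maximalIdeal R)
    (y : Ext (ModuleCat.of R (ResidueField R)) (ModuleCat.of R M) i) : x • y = 0 := by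
  have h : x • 𝟙 (ModuleCat.of R (ResidueField R)) = 0 := by
    ext z
    obtain ⟨z, rfl⟩ := residue_surjective z
    change x • residue R z = 0
    rw [Algebra.smul_def]
    have : algebraMap R (ResidueField R) x = 0 := (residue_eq_zero_iff x).mpr hx
    rw [this, zero_mul]
  rw [← Ext.mk₀_id_comp y, ← Ext.smul_comp, ← Ext.mk₀_smul, h, Ext.mk₀_zero, Ext.zero_comp]

/-- Multiplication by `x` kills `Ext(κ, M)` because `x` kills `κ`. In the long exact sequence
`Ext^i(κ, M/xM)` therefore surjects onto `Ext^(i+1)(κ, M)`. -/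
theorem DepthGE.of_quotSMulTop {d : ℕ} {x : R} (hxm : x ∈ maximalIdeal R)
    (hx : IsSMulRegular M x) (h : DepthGE R d (QuotSMulTop x M)) : DepthGE R (d + 1) M := by
  have hS := linearShortComplex_shortExact (exact_smul_quotSMulTop (M := M) x) hx
    (Submodule.mkQ_surjective _)
  have key : ∀ (i : ℕ) (y : Ext (ModuleCat.of R (ResidueField R)) (ModuleCat.of R M) i),
      y.comp (Ext.mk₀ (linearShortComplex (exact_smul_quotSMulTop (M := M) x)).f)
        (add_zero i) = 0 := by
    intro i y
    have h1 : (linearShortComplex (exact_smul_quotSMulTop (M := M) x)).f =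
      x • 𝟙 (ModuleCat.of R M) := rfl
    rw [h1]
    exact (Ext.smul_eq_comp_mk₀ y x).symm.trans (ext_residueField_smul_eq_zero hxm y)
  intro i hi y
  cases i with
  | zero =>
    apply Ext.postcomp_mk₀_injective_of_mono _
      (linearShortComplex (exact_smul_quotSMulTop (M := M) x)).f (hf := hS.mono_f)
    exact (key 0 y).trans (map_zero _).symm
  | succ i =>
    obtain ⟨z, rfl⟩ := Ext.covariant_sequence_exact₁ _ hS y (key _ y) rfl
    have : z = 0 := h i (by omega) z
    rw [this, Ext.zero_comp]
    rfl

theorem DepthGE.of_isWeaklyRegular {rs : List R} (hrs : ∀ r ∈ rs, r ∈ maximalIdeal R)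
    (h : RingTheory.Sequence.IsWeaklyRegular M rs) : DepthGE R rs.length M := by
  induction rs generalizing M with
  | nil => exact depthGE_zero
  | cons r rs ih =>
    rw [RingTheory.Sequence.isWeaklyRegular_cons_iff] at h
    exact DepthGE.of_quotSMulTop (hrs r (by simp)) h.1
      (ih (fun s hs => hrs s (by simp [hs])) h.2)

/-- An embedding of `κ` into `M` would be a nonzero element of `Ext^0(κ, M)`. -/
theorem DepthGE.maximalIdeal_notMem_associatedPrimes [IsNoetherianRing R]
    {d : ℕ} (h : DepthGE R (d + 1) M) :
    ¬ IsAssociatedPrime (maximalIdeal R) M := by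
  rw [isAssociatedPrime_iff_exists_injective_linearMap]
  rintro ⟨_, f, hf⟩
  have h0 := h 0 (by omega) (Ext.mk₀ (ModuleCat.ofHom f))
  rw [Ext.mk₀_eq_zero_iff] at h0
  have h1 : f (1 : R ⧸ maximalIdeal R) = 0 := congrArg (fun g => g.hom (1 : R ⧸ maximalIdeal R)) h0
  rw [← map_zero f] at h1
  exact one_ne_zero (hf h1)

theorem DepthGE.exists_isSMulRegular [IsNoetherianRing R] [Module.Finite R M]
    {d : ℕ} (h : DepthGE R (d + 1) M) : ∃ x ∈ maximalIdeal R, IsSMulRegular M x := by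
  refine exists_isSMulRegular_mem _ fun P hP hle => ?_
  have : P = maximalIdeal R := ((maximalIdeal.isMaximal R).eq_of_le hP.1.ne_top hle).symm
  exact h.maximalIdeal_notMem_associatedPrimes (this ▸ hP)

theorem DepthGE.exists_isWeaklyRegular [IsNoetherianRing R] [Module.Finite R M]
    {d : ℕ} (h : DepthGE R d M) : ∃ rs : List R, rs.length = d ∧
      (∀ r ∈ rs, r ∈ maximalIdeal R) ∧ RingTheory.Sequence.IsWeaklyRegular M rs := by
  induction d generalizing M with
  | zero => exact ⟨[], rfl, by simp, .nil R M⟩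
  | succ d ih =>
    obtain ⟨x, hxm, hx⟩ := h.exists_isSMulRegular
    obtain ⟨rs, hl, hm, hw⟩ := ih (h.quotSMulTop hx)
    exact ⟨x :: rs, by simp [hl], by simpa using ⟨hxm, hm⟩, .cons hx hw⟩

/-- An associated prime `P` of `M` and an `M`-regular element `x` in the maximal ideal give an
associated prime of `M/xM` that contains `P` and `x`. -/
theorem exists_isAssociatedPrime_quotSMulTop [IsNoetherianRing R] [Module.Finite R M]
    {P : Ideal R} (hP : IsAssociatedPrime P M) {x : R} (hxm : x ∈ maximalIdeal R)
    (hx : IsSMulRegular M x) :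
    ∃ Q, IsAssociatedPrime Q (QuotSMulTop x M) ∧ P ≤ Q ∧ x ∈ Q := by
  obtain ⟨hPp, y, hy⟩ := isAssociatedPrime_iff.mp hP
  let N : Submodule R M := Submodule.torsionBySet R M P
  have hyN : y ∈ N := by
    rw [Submodule.mem_torsionBySet_iff]
    rintro ⟨a, ha⟩
    have ha' : a ∈ P := ha
    rw [hy] at ha'
    simpa [Submodule.mem_colon_singleton] using ha'
  have hy0 : y ≠ 0 := by
    rintro rfl
    apply hPp.ne_top
    rw [hy, Ideal.eq_top_iff_one]
    simp
  -- If `N`, the part of `M` killed by `P`, were contained in `xM`, regularity of `x` would give `N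
  -- = xN`, and Nakayama's lemma would give `N = 0`. The class of such a `z` in `M/xM` is nonzero
  -- and killed by both `P` and `x`.
  have hex : ∃ z ∈ N, z ∉ x • (⊤ : Submodule R M) := by
    by_contra! hcon
    apply hy0
    have hN : N ≤ (maximalIdeal R) • N := by
      intro z hz
      obtain ⟨t, -, rfl⟩ := (Submodule.mem_smul_pointwise_iff_exists _ _ _).mp (hcon z hz)
      refine Submodule.smul_mem_smul hxm ?_
      rw [Submodule.mem_torsionBySet_iff] at hz ⊢
      intro a
      apply hx
      change x • (a : R) • t = x • 0
      rw [smul_zero, smul_comm]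
      exact hz a
    have := Submodule.eq_bot_of_le_smul_of_le_jacobson_bot (maximalIdeal R) N
      (IsNoetherian.noetherian N) hN (maximalIdeal_le_jacobson ⊥)
    rw [this] at hyN
    simpa using hyN
  obtain ⟨z, hzN, hz⟩ := hex
  have hz0 : (Submodule.Quotient.mk z : QuotSMulTop x M) ≠ 0 := by
    rwa [Ne, Submodule.Quotient.mk_eq_zero]
  obtain ⟨Q, hQ, hle⟩ := exists_le_isAssociatedPrime_of_isNoetherianRing R _ hz0
  refine ⟨Q, hQ, fun a ha => hle ?_, hle ?_⟩
  · rw [Submodule.mem_colon_singleton, ← Submodule.Quotient.mk_smul]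
    have : a • z = 0 := (Submodule.mem_torsionBySet_iff _ _).mp hzN ⟨a, ha⟩
    simp [this]
  · rw [Submodule.mem_colon_singleton, ← Submodule.Quotient.mk_smul, Submodule.mem_bot,
      Submodule.Quotient.mk_eq_zero]
    exact Submodule.smul_mem_pointwise_smul _ _ _ trivial

/-- Depth is at most `dim R/P` for every associated prime `P`: passing to `M/xM` lowers the depth
bound by one and replaces `P` by a strictly larger associated prime. -/
theorem DepthGE.le_coheight [IsNoetherianRing R] [Module.Finite R M]
    {e : ℕ} (h : DepthGE R e M) {P : PrimeSpectrum R} (hP : IsAssociatedPrime P.asIdeal M) :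
    (e : ℕ∞) ≤ Order.coheight P := by
  induction e generalizing M P with
  | zero => simp
  | succ e ih =>
    obtain ⟨x, hxm, hx⟩ := h.exists_isSMulRegular
    obtain ⟨Q, hQ, hle, hxQ⟩ := exists_isAssociatedPrime_quotSMulTop hP hxm hx
    have h1 := ih (h.quotSMulTop hx) (P := ⟨Q, hQ.1⟩) hQ
    have hlt : P < (⟨Q, hQ.1⟩ : PrimeSpectrum R) := by
      refine lt_of_le_of_ne hle ?_
      rintro rfl
      have : x ∈ ⋃ p ∈ associatedPrimes R M, (p : Set R) := Set.mem_biUnion hP hxQ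
      rw [biUnion_associatedPrimes_eq_zero_divisors] at this
      obtain ⟨m, hm0, hm⟩ := this
      exact hm0 ((isSMulRegular_iff_right_eq_zero_of_smul).mp hx m hm)
    calc ((e + 1 : ℕ) : ℕ∞) = e + 1 := by push_cast; rfl
      _ ≤ Order.coheight (⟨Q, hQ.1⟩ : PrimeSpectrum R) + 1 := by gcongr
      _ ≤ Order.coheight P := Order.coheight_add_one_le hlt

/-- The number `t` makes the induction work. If `P` lies in an associated prime, `le_coheight`
suffices. Otherwise `P` contains an `M`-regular `x`; on `M/xM` the depth bound drops by one, while
heights on the support rise by one, since `x` avoids the minimal primes of the support of `M`. -/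
theorem DepthGE.add_le_height_add_coheight [IsNoetherianRing R] [Module.Finite R M]
    {d t : ℕ} (h : DepthGE R d M)
    (ht : ∀ Q : PrimeSpectrum R, Module.annihilator R M ≤ Q.asIdeal → (t : ℕ∞) ≤ Order.height Q)
    (P : PrimeSpectrum R) (hP : Module.annihilator R M ≤ P.asIdeal) :
    (d : ℕ∞) + t ≤ Order.height P + Order.coheight P := by
  induction d generalizing M t with
  | zero => simpa using le_add_right (ht P hP)
  | succ d ih =>
    by_cases hex : ∃ Q, IsAssociatedPrime Q M ∧ P.asIdeal ≤ Q
    · obtain ⟨Q, hQ, hle⟩ := hex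
      have h1 := h.le_coheight (P := ⟨Q, hQ.1⟩) hQ
      have h2 : Order.coheight (⟨Q, hQ.1⟩ : PrimeSpectrum R) ≤ Order.coheight P :=
        Order.coheight_anti hle
      rw [add_comm]
      exact add_le_add (ht P hP) (h1.trans h2)
    · push Not at hex
      obtain ⟨x, hxP, hx⟩ := exists_isSMulRegular_mem (M := M) P.asIdeal hex
      have h1 := ih (h.quotSMulTop hx) (t := t + 1) ?_ ?_
      · refine le_trans (le_of_eq ?_) h1
        push_cast
        ring
      · intro Q hQ
        have hxQ : x ∈ Q.asIdeal := by
          apply hQ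
          rw [Module.mem_annihilator]
          intro m
          obtain ⟨m, rfl⟩ := Submodule.Quotient.mk_surjective _ m
          rw [← Submodule.Quotient.mk_smul, Submodule.Quotient.mk_eq_zero]
          exact Submodule.smul_mem_pointwise_smul _ _ _ trivial
        have hle : Module.annihilator R M ≤ Q.asIdeal := by
          refine le_trans ?_ hQ
          exact LinearMap.annihilator_le_of_surjective _
            (Submodule.mkQ_surjective (x • (⊤ : Submodule R M)))
        obtain ⟨Q0, hQ0, hQ0le⟩ := Ideal.exists_minimalPrimes_le hle
        have hass :=
          Module.associatedPrimes.minimalPrimes_annihilator_subset_associatedPrimes R M hQ0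
        have hxQ0 : x ∉ Q0 := by
          intro hx0
          have : x ∈ ⋃ p ∈ associatedPrimes R M, (p : Set R) := Set.mem_biUnion hass hx0
          rw [biUnion_associatedPrimes_eq_zero_divisors] at this
          obtain ⟨m, hm0, hm⟩ := this
          exact hm0 ((isSMulRegular_iff_right_eq_zero_of_smul).mp hx m hm)
        have hlt : (⟨Q0, hass.1⟩ : PrimeSpectrum R) < Q := by
          refine lt_of_le_of_ne hQ0le ?_
          rintro rfl
          exact hxQ0 hxQ
        push_cast
        exact (add_le_add_left (ht ⟨Q0, hass.1⟩ hQ0.1.2) 1).trans (Order.height_add_one_le hlt)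
      · have hmem : P ∈ Module.support R (QuotSMulTop x M) := by
          rw [Module.support_quotSMulTop]
          exact ⟨by rwa [Module.support_eq_zeroLocus], by simpa using hxP⟩
        rwa [Module.support_eq_zeroLocus] at hmem

end Depth

end WeightedDet

namespace WeightedDet

open IsLocalRing
open scoped Matrix

universe u

/-! ### Depth and dimension of the polynomial ring at closed points -/

section PolynomialRing

theorem IsSMulRegular_quotient_of_isPrime {S : Type*} [CommRing S] {J : Ideal S} [hJ : J.IsPrime]
    {r : S} (hr : r ∉ J) : IsSMulRegular (S ⧸ (J • ⊤ : Submodule S S)) r := by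
  rw [isSMulRegular_iff_right_eq_zero_of_smul]
  intro y hy
  obtain ⟨y, rfl⟩ := Submodule.Quotient.mk_surjective _ y
  rw [← Submodule.Quotient.mk_smul, Submodule.Quotient.mk_eq_zero] at hy
  rw [Submodule.Quotient.mk_eq_zero]
  simp only [smul_eq_mul, Ideal.mul_top] at hy ⊢
  exact (hJ.mem_or_mem hy).resolve_left hr

variable {k : Type u} [Field k] {σ : Type}

/-- The ideal is the kernel of the substitution that sets the variables in `s` to zero. -/
theorem isPrime_span_X_image (s : Set σ) :
    (Ideal.span (MvPolynomial.X '' s) : Ideal (MvPolynomial σ k)).IsPrime := by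
  classical
  set J : Ideal (MvPolynomial σ k) := Ideal.span (MvPolynomial.X '' s) with hJ
  let φ : MvPolynomial σ k →ₐ[k] MvPolynomial σ k :=
    MvPolynomial.aeval fun i => if i ∈ s then 0 else MvPolynomial.X i
  have h1 : (Ideal.Quotient.mkₐ k J).comp φ = Ideal.Quotient.mkₐ k J := by
    ext i
    by_cases hi : i ∈ s
    · have : MvPolynomial.X i ∈ J := Ideal.subset_span ⟨i, hi, rfl⟩
      simp [φ, hi, Ideal.Quotient.eq_zero_iff_mem.mpr this]
    · simp [φ, hi]
  have h2 : J = RingHom.ker φ := by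
    apply le_antisymm
    · rw [hJ, Ideal.span_le]
      rintro _ ⟨i, hi, rfl⟩
      simp [φ, hi, RingHom.mem_ker]
    · intro f hf
      rw [RingHom.mem_ker] at hf
      have := DFunLike.congr_fun h1 f
      rw [AlgHom.comp_apply, hf, map_zero] at this
      exact Ideal.Quotient.eq_zero_iff_mem.mp this.symm
  rw [h2]
  exact RingHom.ker_isPrime _

theorem isWeaklyRegular_X (l : List σ) (hl : l.Nodup) :
    RingTheory.Sequence.IsWeaklyRegular (MvPolynomial σ k)
      (l.map (MvPolynomial.X : σ → MvPolynomial σ k)) := by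
  constructor
  intro i hi
  have h1 : Ideal.ofList ((l.map (MvPolynomial.X : σ → MvPolynomial σ k)).take i) =
      Ideal.span (MvPolynomial.X '' {j | j ∈ l.take i}) := by
    rw [Ideal.ofList]
    congr 1
    ext x
    simp [← List.map_take]
  rw [h1]
  have : (Ideal.span (MvPolynomial.X '' {j | j ∈ l.take i}) :
    Ideal (MvPolynomial σ k)).IsPrime := isPrime_span_X_image _
  apply IsSMulRegular_quotient_of_isPrime
  rw [List.length_map] at hi
  rw [MvPolynomial.mem_ideal_span_X_image, List.getElem_map]
  intro h
  obtain ⟨j, hj, hj0⟩ := h (Finsupp.single l[i] 1) (by simp [MvPolynomial.support_X])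
  have : l[i] = j := by
    by_contra hne
    exact hj0 (Finsupp.single_eq_of_ne (Ne.symm hne))
  subst this
  obtain ⟨m, hm, hm'⟩ := List.mem_take_iff_getElem.mp hj
  have := (List.Nodup.getElem_inj_iff hl).mp hm'
  omega

/-- Translation by the vector `a`, as an automorphism of the polynomial ring. -/
noncomputable def translation (a : σ → k) : MvPolynomial σ k ≃ₐ[k] MvPolynomial σ k :=
  AlgEquiv.ofAlgHom (MvPolynomial.aeval fun i => MvPolynomial.X i - MvPolynomial.C (a i))
    (MvPolynomial.aeval fun i => MvPolynomial.X i + MvPolynomial.C (a i))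
    (by ext i; simp) (by ext i; simp)

theorem isWeaklyRegular_X_sub_C (a : σ → k) (l : List σ) (hl : l.Nodup) :
    RingTheory.Sequence.IsWeaklyRegular (MvPolynomial σ k)
      (l.map fun i => MvPolynomial.X i - MvPolynomial.C (a i)) := by
  refine ((translation a).toAddEquiv.isWeaklyRegular_congr ?_).mp (isWeaklyRegular_X l hl)
  rw [List.forall₂_map_right_iff, List.forall₂_map_left_iff, List.forall₂_same]
  intro i _ x
  simp [translation]

variable [IsAlgClosed k] [Fintype σ]

/-- By the Nullstellensatz `𝔫` is the ideal of a point `a`, and the functions `X i - a i` form a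
regular sequence in it. -/
theorem depthGE_localization_mvPolynomial (𝔫 : Ideal (MvPolynomial σ k)) [h𝔫 : 𝔫.IsMaximal] :
    DepthGE (Localization.AtPrime 𝔫) (Fintype.card σ) (Localization.AtPrime 𝔫) := by
  obtain ⟨a, ha⟩ := MvPolynomial.isMaximal_iff_eq_vanishingIdeal_singleton.mp h𝔫
  have h1 := (isWeaklyRegular_X_sub_C a Finset.univ.toList
    Finset.univ.nodup_toList).of_isLocalization (Localization.AtPrime 𝔫) 𝔫.primeCompl
  have h2 := DepthGE.of_isWeaklyRegular ?_ h1
  · simpa using h2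
  · intro r hr
    simp only [List.map_map, List.mem_map, Finset.mem_toList, Finset.mem_univ, true_and] at hr
    obtain ⟨i, rfl⟩ := hr
    refine (IsLocalization.AtPrime.to_map_mem_maximal_iff (Localization.AtPrime 𝔫) 𝔫 _).mpr ?_
    simp [ha, MvPolynomial.mem_vanishingIdeal_iff]

theorem height_eq_card_of_isMaximal (𝔫 : Ideal (MvPolynomial σ k)) [h𝔫 : 𝔫.IsMaximal] :
    𝔫.height = Fintype.card σ := by
  apply le_antisymm
  · have h1 := Ideal.height_le_ringKrullDim_of_isPrime (I := 𝔫)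
    rw [MvPolynomial.ringKrullDim_of_isNoetherianRing, ringKrullDim_eq_zero_of_field, zero_add,
      Nat.card_eq_fintype_card] at h1
    exact WithBot.coe_le_coe.mp h1
  · obtain ⟨P, hP⟩ := associatedPrimes.nonempty (Localization.AtPrime 𝔫) (Localization.AtPrime 𝔫)
    have h1 := (depthGE_localization_mvPolynomial 𝔫).le_coheight (P := ⟨P, hP.1⟩) hP
    have h2 := Order.coheight_le_krullDim (⟨P, hP.1⟩ : PrimeSpectrum (Localization.AtPrime 𝔫))
    have h3 := IsLocalization.AtPrime.ringKrullDim_eq_height 𝔫 (Localization.AtPrime 𝔫)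
    rw [ringKrullDim] at h3
    rw [h3] at h2
    exact h1.trans (WithBot.coe_le_coe.mp h2)

/-- The half of the dimension formula that needs the Cohen–Macaulay property of the polynomial ring:
`add_le_height_add_coheight` for the local ring at `𝔫`, with chains above `P` transported to `S/P`.
-/
theorem card_le_height_add_height {𝔫 P : Ideal (MvPolynomial σ k)} [h𝔫 : 𝔫.IsMaximal]
    [hP : P.IsPrime] (hle : P ≤ 𝔫) :
    (Fintype.card σ : ℕ∞) ≤ P.height + (𝔫.map (Ideal.Quotient.mk P)).height := by
  have hdisj : Disjoint (𝔫.primeCompl : Set (MvPolynomial σ k)) P := by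
    rw [Set.disjoint_left]
    exact fun x hx hxP => hx (hle hxP)
  have hPp := IsLocalization.isPrime_of_isPrime_disjoint 𝔫.primeCompl (Localization.AtPrime 𝔫) P
    hP hdisj
  set P' : PrimeSpectrum (Localization.AtPrime 𝔫) := ⟨_, hPp⟩ with hP'
  have h1 := (depthGE_localization_mvPolynomial 𝔫).add_le_height_add_coheight (t := 0)
    (by simp) P' (by
      intro x hx
      rw [Module.mem_annihilator] at hx
      have := hx 1
      rw [smul_eq_mul, mul_one] at this
      rw [this]
      exact zero_mem _)
  rw [Nat.cast_zero, add_zero, ← PrimeSpectrum.height_eq_orderHeight] at h1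
  have h2 : P'.asIdeal.height = P.height :=
    IsLocalization.height_map_of_disjoint 𝔫.primeCompl P hdisj
  rw [h2] at h1
  refine h1.trans ?_
  gcongr
  have h𝔫' : (𝔫.map (Ideal.Quotient.mk P)).IsPrime := Ideal.isPrime_map_quotientMk_of_isPrime hle
  refine Order.coheight_le fun p hp => ?_
  have hcomap : ∀ i, P ≤ (p i).asIdeal.comap (algebraMap _ (Localization.AtPrime 𝔫)) := by
    intro i
    rw [← Ideal.map_le_iff_le_comap]
    have : p.head ≤ p i := p.head_le i
    rw [hp] at this
    exact this
  let s : LTSeries (PrimeSpectrum (MvPolynomial σ k ⧸ P)) :=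
    { length := p.length
      toFun := fun i => ⟨((p i).asIdeal.comap (algebraMap _ (Localization.AtPrime 𝔫))).map
        (Ideal.Quotient.mk P), Ideal.isPrime_map_quotientMk_of_isPrime (hcomap i)⟩
      step := by
        intro i
        have hlt := p.step i
        refine lt_of_le_of_ne (Ideal.map_mono (Ideal.comap_mono hlt.le)) fun heq => ?_
        have heq' := congrArg (Ideal.comap (Ideal.Quotient.mk P)) heq
        simp only [Ideal.comap_map_of_surjective _ Ideal.Quotient.mk_surjective,
          ← RingHom.ker_eq_comap_bot, Ideal.mk_ker] at heq'
        rw [sup_eq_left.mpr (hcomap _), sup_eq_left.mpr (hcomap _)] at heq'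
        have h3 := congrArg (Ideal.map (algebraMap _ (Localization.AtPrime 𝔫))) heq'
        rw [IsLocalization.map_under 𝔫.primeCompl, IsLocalization.map_under 𝔫.primeCompl] at h3
        exact hlt.ne (PrimeSpectrum.ext h3) }
  have hs : s.last ≤ (⟨_, h𝔫'⟩ : PrimeSpectrum (MvPolynomial σ k ⧸ P)) := by
    refine Ideal.map_mono ?_
    intro x hx
    rw [← IsLocalization.AtPrime.to_map_mem_maximal_iff (Localization.AtPrime 𝔫) 𝔫]
    exact le_maximalIdeal p.last.2.ne_top hx
  have h4 : (s.length : ℕ∞) ≤ _ := Order.length_le_height hs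
  rw [← PrimeSpectrum.height_eq_orderHeight] at h4
  exact h4

end PolynomialRing

/-! ### Minors and column spans of leading blocks -/

section LeadingBlocks

/-- The leading `p × q` block of an infinite matrix. -/
def block {R : Type*} (M : ℕ → ℕ → R) (p q : ℕ) : Matrix (Fin p) (Fin q) R :=
  Matrix.of fun i j => M i j

variable {R : Type u} [CommRing R]

/-- The ideal of maximal minors of the leading `p × q` block. -/
def leadingMinors (M : ℕ → ℕ → R) (p q : ℕ) : Ideal R :=
  Ideal.span (Set.range fun f : Fin p → Fin q => ((block M p q).submatrix id f).det)

/-- The module spanned by the columns of the leading `p × q` block. -/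
def columnSpan (M : ℕ → ℕ → R) (p q : ℕ) : Submodule R (Fin p → R) :=
  LinearMap.range (block M p q).mulVecLin

theorem mem_columnSpan {M : ℕ → ℕ → R} {p q : ℕ} {v : Fin p → R} :
    v ∈ columnSpan M p q ↔ ∃ b : Fin q → R, ∀ i : Fin p, ∑ j : Fin q, M i j * b j = v i := by
  simp only [columnSpan, LinearMap.mem_range, Matrix.mulVecLin_apply, funext_iff]
  rfl

theorem det_mem_leadingMinors (M : ℕ → ℕ → R) {p q : ℕ} (f : Fin p → Fin q) :
    ((block M p q).submatrix id f).det ∈ leadingMinors M p q :=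
  Ideal.subset_span ⟨f, rfl⟩

theorem leadingMinors_zero (M : ℕ → ℕ → R) (q : ℕ) : leadingMinors M 0 q = ⊤ := by
  rw [Ideal.eq_top_iff_one]
  have := det_mem_leadingMinors M (Fin.elim0 : Fin 0 → Fin q)
  rwa [Matrix.det_fin_zero] at this

theorem leadingMinors_le_succ (M : ℕ → ℕ → R) (p q : ℕ) :
    leadingMinors M p q ≤ leadingMinors M p (q + 1) := by
  rw [leadingMinors, Ideal.span_le]
  rintro _ ⟨f, rfl⟩
  exact det_mem_leadingMinors M (Fin.castSucc ∘ f)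

theorem mul_one_submatrix {m n l : Type*} [Fintype n] [DecidableEq n] (A : Matrix m n R)
    (f : l → n) : A * (1 : Matrix n n R).submatrix id f = A.submatrix id f := by
  ext i j
  simp [Matrix.mul_apply, Matrix.one_apply]

/-- Cramer's rule: the adjugate of the chosen square submatrix solves the system with right-hand
side `det • v`. So the maximal minors annihilate the cokernel. -/
theorem smul_mem_columnSpan (M : ℕ → ℕ → R) {p q : ℕ} {a : R} (ha : a ∈ leadingMinors M p q)
    (v : Fin p → R) : a • v ∈ columnSpan M p q := by
  classical
  induction ha using Submodule.span_induction with
  | zero => simp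
  | add a b _ _ ha hb => rw [add_smul]; exact add_mem ha hb
  | smul c a _ ha => rw [smul_assoc]; exact Submodule.smul_mem _ _ ha
  | mem a ha =>
    obtain ⟨f, rfl⟩ := ha
    refine ⟨(1 : Matrix (Fin q) (Fin q) R).submatrix id f *ᵥ
      (((block M p q).submatrix id f).adjugate *ᵥ v), ?_⟩
    rw [Matrix.mulVecLin_apply, Matrix.mulVec_mulVec, mul_one_submatrix, Matrix.mulVec_mulVec,
      Matrix.mul_adjugate, Matrix.smul_mulVec, Matrix.one_mulVec]

/-- The `q`-th column of `M`, truncated to its first `p` entries. -/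
def leadingColumn (M : ℕ → ℕ → R) (p q : ℕ) : Fin p → R := fun i => M i q

/-- In a minor involving column `q`, multiply that column by `a` and replace it by a combination of
earlier columns; multilinearity turns the result into minors of the first `q` columns. -/
theorem mul_mem_leadingMinors (M : ℕ → ℕ → R) {p q : ℕ} {a : R}
    (ha : a • leadingColumn M p q ∈ columnSpan M p q) {x : R}
    (hx : x ∈ leadingMinors M p (q + 1)) : a * x ∈ leadingMinors M p q := by
  classical
  induction hx using Submodule.span_induction with
  | zero => simp
  | add x y _ _ hx hy => rw [mul_add]; exact add_mem hx hy
  | smul c x _ hx => rw [smul_eq_mul, mul_left_comm]; exact Ideal.mul_mem_left _ _ hx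
  | mem x hx =>
    obtain ⟨g, rfl⟩ := hx
    beta_reduce
    set A := (block M p (q + 1)).submatrix id g with hA
    by_cases hinj : Function.Injective g
    swap
    · obtain ⟨j₁, j₂, he, hne⟩ := Function.not_injective_iff.mp hinj
      have : A.det = 0 := Matrix.det_zero_of_column_eq hne (by intro i; simp [hA, he])
      simp [this]
    by_cases hlast : ∃ j₀, g j₀ = Fin.last q
    swap
    · push Not at hlast
      refine Ideal.mul_mem_left _ _ ?_
      have : A = (block M p q).submatrix id (fun j => (g j).castPred (hlast j)) := by
        ext i j
        rfl
      rw [this]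
      exact det_mem_leadingMinors M _
    obtain ⟨j₀, hj₀⟩ := hlast
    obtain ⟨b, hb⟩ := mem_columnSpan.mp ha
    have h1 : a * A.det = ∑ j : Fin q, b j * (A.updateCol j₀ (leadingColumn M p j)).det := by
      have h2 : A = A.updateCol j₀ (leadingColumn M p q) := by
        ext i j
        rcases eq_or_ne j j₀ with rfl | hne
        · simp [hA, leadingColumn, block, hj₀]
        · simp [hne]
      have h3 : a • leadingColumn M p q = ∑ j : Fin q, b j • leadingColumn M p j := by
        ext i
        rw [← hb i]
        simp [leadingColumn, mul_comm]
      conv_lhs => rw [h2]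
      rw [← Matrix.det_updateCol_smul, h3]
      simp only [← Matrix.cramer_apply, map_sum, map_smul, Finset.sum_apply, Pi.smul_apply,
        smul_eq_mul]
    rw [h1]
    refine sum_mem fun j _ => Ideal.mul_mem_left _ _ ?_
    have hne : ∀ j' ≠ j₀, g j' ≠ Fin.last q := fun j' hj' h => hj' (hinj (h.trans hj₀.symm))
    have h4 : A.updateCol j₀ (leadingColumn M p j) = (block M p q).submatrix id
        (fun j' => if h : j' = j₀ then j else (g j').castPred (hne j' h)) := by
      ext i j'
      rcases eq_or_ne j' j₀ with rfl | h
      · simp [leadingColumn, block]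
      · simp [h, hA, block]
    rw [h4]
    exact det_mem_leadingMinors M _

end LeadingBlocks

/-! ### Depth along `0 → R/I → E/K → E/(K + Rv) → 0` -/

section DepthOfQuotients

variable {R : Type u} [CommRing R] {E : Type u} [AddCommGroup E] [Module R E]

/-- The map `R ⧸ I → E ⧸ K` that sends `1` to the class of `v`. -/
def quotientToSpan {K : Submodule R E} {v : E} {I : Ideal R} (hI : ∀ a, a • v ∈ K ↔ a ∈ I) :
    (R ⧸ I) →ₗ[R] E ⧸ K :=
  Submodule.liftQ I ((Submodule.mkQ K).comp (LinearMap.toSpanSingleton R E v)) (by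
    intro a ha
    rw [LinearMap.mem_ker, LinearMap.comp_apply, LinearMap.toSpanSingleton_apply,
      Submodule.mkQ_apply, Submodule.Quotient.mk_eq_zero]
    exact (hI a).mpr ha)

theorem quotientToSpan_injective {K : Submodule R E} {v : E} {I : Ideal R}
    (hI : ∀ a, a • v ∈ K ↔ a ∈ I) : Function.Injective (quotientToSpan hI) := by
  rw [← LinearMap.ker_eq_bot]
  refine Submodule.ker_liftQ_eq_bot _ _ _ fun a ha => ?_
  rw [LinearMap.mem_ker, LinearMap.comp_apply, LinearMap.toSpanSingleton_apply,
    Submodule.mkQ_apply, Submodule.Quotient.mk_eq_zero] at ha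
  exact (hI a).mp ha

theorem exact_quotientToSpan {K : Submodule R E} {v : E} {I : Ideal R}
    (hI : ∀ a, a • v ∈ K ↔ a ∈ I) :
    Function.Exact (quotientToSpan hI)
      (Submodule.factor (le_sup_left : K ≤ K ⊔ Submodule.span R {v})) := by
  intro x
  obtain ⟨x, rfl⟩ := Submodule.Quotient.mk_surjective _ x
  change (Submodule.Quotient.mk x : E ⧸ K ⊔ Submodule.span R {v}) = 0 ↔ _
  rw [Submodule.Quotient.mk_eq_zero, Submodule.mem_sup]
  constructor
  · rintro ⟨y, hy, z, hz, rfl⟩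
    obtain ⟨a, rfl⟩ := Submodule.mem_span_singleton.mp hz
    refine ⟨Ideal.Quotient.mk I a, ?_⟩
    rw [Submodule.Quotient.mk_add, (Submodule.Quotient.mk_eq_zero K).mpr hy, zero_add]
    rfl
  · rintro ⟨a, ha⟩
    obtain ⟨a, rfl⟩ := Ideal.Quotient.mk_surjective a
    have ha' : (Submodule.Quotient.mk (a • v) : E ⧸ K) = Submodule.Quotient.mk x := ha
    refine ⟨x - a • v, ?_, a • v, Submodule.mem_span_singleton.mpr ⟨a, rfl⟩, by simp⟩
    exact (Submodule.Quotient.eq K).mp ha'.symm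

variable [IsLocalRing R]

theorem DepthGE.quotient_sup_span {K : Submodule R E} {v : E} {I : Ideal R}
    (hI : ∀ a, a • v ∈ K ↔ a ∈ I) {d : ℕ} (h1 : DepthGE R (d + 1) (R ⧸ I))
    (h2 : DepthGE R d (E ⧸ K)) : DepthGE R d (E ⧸ K ⊔ Submodule.span R {v}) :=
  .of_exact_right (exact_quotientToSpan hI) (quotientToSpan_injective hI)
    (Submodule.factor_surjective _) h1 h2

theorem DepthGE.quotient_ideal {K : Submodule R E} {v : E} {I : Ideal R}
    (hI : ∀ a, a • v ∈ K ↔ a ∈ I) {d : ℕ} (h1 : DepthGE R (d + 1) (E ⧸ K))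
    (h2 : DepthGE R d (E ⧸ K ⊔ Submodule.span R {v})) : DepthGE R (d + 1) (R ⧸ I) :=
  .of_exact_left (exact_quotientToSpan hI) (quotientToSpan_injective hI)
    (Submodule.factor_surjective _) h1 h2

end DepthOfQuotients

/-! ### Relations between columns -/

section Syzygies

theorem block_update {R : Type*} (M : ℕ → ℕ → R) (p q : ℕ) (r : ℕ → R) :
    block (Function.update M p r) p q = block M p q := by
  ext i j
  simp [block, Function.update_of_ne i.isLt.ne]

variable {R : Type u} [CommRing R]

theorem leadingColumn_mem_columnSpan (M : ℕ → ℕ → R) {p q j : ℕ} (hj : j < q) :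
    leadingColumn M p j ∈ columnSpan M p q := by
  classical
  rw [mem_columnSpan]
  refine ⟨Pi.single ⟨j, hj⟩ 1, fun i => ?_⟩
  simp [Pi.single_apply, leadingColumn]

theorem columnSpan_succ (M : ℕ → ℕ → R) (p q : ℕ) :
    columnSpan M p (q + 1) = columnSpan M p q ⊔ Submodule.span R {leadingColumn M p q} := by
  apply le_antisymm
  · intro v hv
    obtain ⟨b, hb⟩ := mem_columnSpan.mp hv
    have : v = (fun i : Fin p => ∑ j : Fin q, M i j * b j.castSucc) +
        b (Fin.last q) • leadingColumn M p q := by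
      ext i
      rw [← hb i, Fin.sum_univ_castSucc]
      simp [leadingColumn, mul_comm]
    rw [this]
    exact Submodule.add_mem_sup (mem_columnSpan.mpr ⟨_, fun i => rfl⟩)
      (Submodule.mem_span_singleton.mpr ⟨_, rfl⟩)
  · apply sup_le
    · intro v hv
      obtain ⟨b, hb⟩ := mem_columnSpan.mp hv
      refine mem_columnSpan.mpr ⟨Fin.snoc b 0, fun i => ?_⟩
      rw [Fin.sum_univ_castSucc]
      simp [← hb i]
    · rw [Submodule.span_singleton_le_iff_mem]
      exact leadingColumn_mem_columnSpan M (Nat.lt_succ_self q)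

/-- The cokernel of the `p × q` block is the cokernel of the `(p + 1) × q` block modulo the last
unit vector. -/
noncomputable def cokernelSuccEquiv (M : ℕ → ℕ → R) (p q : ℕ) :
    ((Fin (p + 1) → R) ⧸ columnSpan M (p + 1) q ⊔ Submodule.span R {Pi.single (Fin.last p) 1})
      ≃ₗ[R] (Fin p → R) ⧸ columnSpan M p q := by
  let f : (Fin (p + 1) → R) →ₗ[R] (Fin p → R) := LinearMap.funLeft R R Fin.castSucc
  have hf : Function.Surjective f :=
    LinearMap.funLeft_surjective_of_injective R R _ (Fin.castSucc_injective p)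
  have h1 : LinearMap.ker f = Submodule.span R {Pi.single (Fin.last p) 1} := by
    ext v
    rw [LinearMap.mem_ker, Submodule.mem_span_singleton]
    constructor
    · intro hv
      refine ⟨v (Fin.last p), ?_⟩
      ext i
      refine Fin.lastCases ?_ (fun i => ?_) i
      · simp
      · have := congrFun hv i
        simpa [f, LinearMap.funLeft_apply] using this.symm
    · rintro ⟨a, rfl⟩
      ext i
      simp [f, LinearMap.funLeft_apply]
  have h2 : (columnSpan M (p + 1) q).map f = columnSpan M p q := by
    ext v
    simp only [Submodule.mem_map, mem_columnSpan]
    constructor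
    · rintro ⟨w, ⟨b, hb⟩, rfl⟩
      exact ⟨b, fun i => hb i.castSucc⟩
    · rintro ⟨b, hb⟩
      exact ⟨_, ⟨b, fun i => rfl⟩, funext hb⟩
  have h3 : columnSpan M (p + 1) q ⊔ Submodule.span R {Pi.single (Fin.last p) 1} =
      LinearMap.ker ((columnSpan M p q).mkQ.comp f) := by
    rw [LinearMap.ker_comp, Submodule.ker_mkQ, ← h2, Submodule.comap_map_eq, h1]
  exact (Submodule.quotEquivOfEq _ _ h3).trans
    (((columnSpan M p q).mkQ.comp f).quotKerEquivOfSurjective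
      ((Submodule.mkQ_surjective _).comp hf))

/-- The maximal minors of the matrix obtained from the leading `p × q` block by appending the
row `r`. -/
def appendedMinors (M : ℕ → ℕ → R) (p q : ℕ) (r : ℕ → R) : Ideal R :=
  leadingMinors (Function.update M p r) (p + 1) q

/-- A minor `a` of the first `q` columns is the last coordinate of a relation between `q + 1`
columns. The coordinates are cofactors for an appended row, so pairing them with any row `r` gives a
minor of the enlarged matrix. -/
theorem exists_cramer_vector (M : ℕ → ℕ → R) {p q : ℕ} {a : R} (ha : a ∈ leadingMinors M p q) :
    ∃ v : Fin (q + 1) → R, v (Fin.last q) = a ∧ (∀ i : Fin p, ∑ j : Fin (q + 1), M i j * v j = 0) ∧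
      ∀ r : ℕ → R, ∑ j : Fin (q + 1), r j * v j ∈ appendedMinors M p (q + 1) r := by
  classical
  induction ha using Submodule.span_induction with
  | zero => exact ⟨0, by simp⟩
  | add a b _ _ ha hb =>
    obtain ⟨v, hv1, hv2, hv3⟩ := ha
    obtain ⟨w, hw1, hw2, hw3⟩ := hb
    refine ⟨v + w, by simp [hv1, hw1], fun i => ?_, fun r => ?_⟩
    · simp [mul_add, Finset.sum_add_distrib, hv2, hw2]
    · simpa [mul_add, Finset.sum_add_distrib] using add_mem (hv3 r) (hw3 r)
  | smul c a _ ha =>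
    obtain ⟨v, hv1, hv2, hv3⟩ := ha
    refine ⟨c • v, by simp [hv1], fun i => ?_, fun r => ?_⟩
    · simp [mul_left_comm _ c, ← Finset.mul_sum, hv2]
    · simpa [mul_left_comm _ c, ← Finset.mul_sum] using Ideal.mul_mem_left _ c (hv3 r)
  | mem a ha =>
    obtain ⟨f, rfl⟩ := ha
    -- `g` adds column `q` to the columns chosen by `f`, and `u` lists the cofactors along the
    -- appended row.
    let g : Fin (p + 1) → Fin (q + 1) := Fin.snoc (fun j => (f j).castSucc) (Fin.last q)
    let u : Fin (p + 1) → R := fun j => (-1) ^ (p + (j : ℕ)) *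
      ((block M p (q + 1)).submatrix id (g ∘ j.succAbove)).det
    have key : ∀ r : ℕ → R,
        ((block (Function.update M p r) (p + 1) (q + 1)).submatrix id g).det =
          ∑ j, r (g j) * u j := by
      intro r
      rw [Matrix.det_succ_row _ (Fin.last p)]
      refine Finset.sum_congr rfl fun j _ => ?_
      have h1 : ((block (Function.update M p r) (p + 1) (q + 1)).submatrix id g).submatrix
          (Fin.last p).succAbove j.succAbove =
          (block M p (q + 1)).submatrix id (g ∘ j.succAbove) := by
        rw [← block_update M p (q + 1) r]
        ext i j
        simp [block]
      rw [h1]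
      simp only [Matrix.submatrix_apply, id, block, Matrix.of_apply, Fin.val_last,
        Function.update_self, u]
      ring
    let v : Fin (q + 1) → R := fun t => ∑ j, if g j = t then u j else 0
    have hv : ∀ r : ℕ → R, ∑ t : Fin (q + 1), r t * v t = ∑ j, r (g j) * u j := by
      intro r
      simp only [v, Finset.mul_sum]
      rw [Finset.sum_comm]
      refine Finset.sum_congr rfl fun j _ => ?_
      simp
    refine ⟨v, ?_, fun i => ?_, fun r => ?_⟩
    · simp only [v]
      rw [Fin.sum_univ_castSucc]
      have h1 : ∀ j : Fin p, g j.castSucc ≠ Fin.last q := by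
        intro j
        simp [g, Fin.castSucc_ne_last]
      have h2 : g ∘ (Fin.last p).succAbove = fun j => (f j).castSucc := by
        ext j
        simp [g]
      simp only [h1, if_false, Finset.sum_const_zero, zero_add, u, h2]
      simp only [g, Fin.snoc_last, if_true, Fin.val_last]
      rw [Even.neg_one_pow ⟨p, rfl⟩, one_mul]
      rfl
    -- Appending a copy of row `i` gives a determinant with two equal rows.
    · rw [hv (M i), ← key]
      refine Matrix.det_zero_of_row_eq (i := i.castSucc) (j := Fin.last p)
        (Fin.castSucc_ne_last i) ?_
      ext j
      simp [block, Function.update_of_ne i.isLt.ne]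
    · rw [hv r, ← key]
      exact det_mem_leadingMinors _ _

theorem det_block_ne_zero [IsDomain R] (M : ℕ → ℕ → R) (p : ℕ)
    (h : leadingMinors M p p ≠ ⊥) : (block M p p).det ≠ 0 := by
  intro h0
  apply h
  rw [leadingMinors, Ideal.span_eq_bot]
  rintro _ ⟨f, rfl⟩
  beta_reduce
  rw [← mul_one_submatrix, Matrix.det_mul, h0, zero_mul]

/-- If `a • (q'-th column) ∈ columnSpan M p q'` forces `a ∈ leadingMinors M p q'` for
`p ≤ q' < q`, the relations between the columns of the leading `p × q` block are generated by
those given by Cramer's rule. -/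
theorem sum_mem_appendedMinors [IsDomain R] (M : ℕ → ℕ → R) {p q : ℕ} (hpq : p ≤ q)
    (hdet : (block M p p).det ≠ 0)
    (hk : ∀ q', p ≤ q' → q' < q → ∀ a : R,
      a • leadingColumn M p q' ∈ columnSpan M p q' → a ∈ leadingMinors M p q')
    (b : Fin q → R) (hb : ∀ i : Fin p, ∑ j : Fin q, M i j * b j = 0) (r : ℕ → R) :
    ∑ j : Fin q, r j * b j ∈ appendedMinors M p q r := by
  induction q, hpq using Nat.le_induction with
  | base =>
    have : b = 0 := Matrix.eq_zero_of_mulVec_eq_zero hdet (funext hb)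
    simp [this]
  | succ q hpq ih =>
    -- The relation puts `b_q` times column `q` in the span of the earlier columns. Subtracting a
    -- Cramer relation with the same last coordinate leaves a relation between `q` columns.
    have h1 : b (Fin.last q) ∈ leadingMinors M p q := by
      refine hk q hpq (Nat.lt_succ_self q) _ (mem_columnSpan.mpr
        ⟨fun j => - b j.castSucc, fun i => ?_⟩)
      have := hb i
      rw [Fin.sum_univ_castSucc] at this
      simp only [mul_neg, Finset.sum_neg_distrib, Pi.smul_apply, smul_eq_mul, leadingColumn]
      simp only [Fin.val_castSucc, Fin.val_last] at this
      linear_combination -this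
    obtain ⟨v, hv1, hv2, hv3⟩ := exists_cramer_vector M h1
    have h2 := ih (fun q' h h' => hk q' h (by omega)) (fun j => b j.castSucc - v j.castSucc) (by
      intro i
      have e1 := hb i
      have e2 := hv2 i
      rw [Fin.sum_univ_castSucc] at e1 e2
      rw [hv1] at e2
      simp only [mul_sub, Finset.sum_sub_distrib]
      simp only [Fin.val_castSucc] at e1 e2
      linear_combination e1 - e2)
    have h3 := add_mem (leadingMinors_le_succ _ _ _ h2) (hv3 r)
    have h4 : ∑ j : Fin (q + 1), r j * b j = (∑ j : Fin q, r j * (b j.castSucc - v j.castSucc)) +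
        ∑ j : Fin (q + 1), r j * v j := by
      rw [Fin.sum_univ_castSucc, Fin.sum_univ_castSucc, hv1]
      simp only [mul_sub, Finset.sum_sub_distrib, Fin.val_castSucc]
      ring
    rw [h4]
    exact h3

end Syzygies

/-! ### Depth of determinantal rings and of the cokernels -/

section DepthOfMinors

theorem height_add_coheight_le {R : Type*} [CommRing R] {d : ℕ} (hdim : ringKrullDim R ≤ d)
    (P : PrimeSpectrum R) : P.asIdeal.height + Order.coheight P ≤ d := by
  have : Nonempty (PrimeSpectrum R) := ⟨P⟩
  have h : ((Order.height P + Order.coheight P : ℕ∞) : WithBot ℕ∞) ≤ d := by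
    refine le_trans ?_ hdim
    rw [ringKrullDim, Order.krullDim_eq_iSup_height_add_coheight_of_nonempty]
    exact WithBot.coe_le_coe.mpr (le_iSup (fun a : PrimeSpectrum R =>
      Order.height a + Order.coheight a) _)
  rw [PrimeSpectrum.height_eq_orderHeight]
  exact WithBot.coe_le_coe.mp h

variable {R : Type u} [CommRing R] [IsLocalRing R] [IsNoetherianRing R]

/-- If `a ∉ I(p,q)`, an associated prime `P` of `R/I(p,q)` contains the annihilator of the class of
`a`, hence `I(p,q+1)`, and has height at least `q + 2 - p`. But the depth hypothesis gives `dim R/P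
≥ d - (q + 1 - p)`, which is too large. -/
theorem mem_leadingMinors_of_smul_mem {d : ℕ} (hdim : ringKrullDim R ≤ d) (M : ℕ → ℕ → R)
    {p q : ℕ} (hpq : p ≤ q) (h : DepthGE R (d - (q + 1 - p)) (R ⧸ leadingMinors M p q))
    (hH : ∀ P : Ideal R, P.IsPrime → leadingMinors M p (q + 1) ≤ P →
      ((q + 2 - p : ℕ) : ℕ∞) ≤ P.height)
    (a : R) (ha : a • leadingColumn M p q ∈ columnSpan M p q) : a ∈ leadingMinors M p q := by
  by_contra hne
  have h0 : Ideal.Quotient.mk (leadingMinors M p q) a ≠ 0 := by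
    rwa [Ne, Ideal.Quotient.eq_zero_iff_mem]
  obtain ⟨P, hP, hle⟩ := exists_le_isAssociatedPrime_of_isNoetherianRing R _ h0
  have h1 : leadingMinors M p (q + 1) ≤ P := by
    intro x hx
    apply hle
    rw [Submodule.mem_colon_singleton, Submodule.mem_bot, Algebra.smul_def,
      Ideal.Quotient.algebraMap_eq, ← map_mul, Ideal.Quotient.eq_zero_iff_mem, mul_comm]
    exact mul_mem_leadingMinors M ha hx
  have h2 := h.le_coheight (P := ⟨P, hP.1⟩) hP
  have h3 := hH P hP.1 h1
  have h6 : ((q + 2 - p : ℕ) : ℕ∞) + ((d - (q + 1 - p) : ℕ) : ℕ∞) ≤ (d : ℕ∞) :=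
    (add_le_add h3 h2).trans (height_add_coheight_le hdim ⟨P, hP.1⟩)
  have h7 : (q + 2 - p) + (d - (q + 1 - p)) ≤ d := by exact_mod_cast h6
  omega

theorem depthGE_quotient_leadingMinors [IsDomain R] {d : ℕ} (hd : DepthGE R d R)
    (hdim : ringKrullDim R ≤ d) (M : ℕ → ℕ → R) {p q : ℕ}
    (hH : ∀ p' ≤ p, ∀ q' ≤ q, p' ≤ q' → ∀ P : Ideal R, P.IsPrime → leadingMinors M p' q' ≤ P →
      ((q' + 1 - p' : ℕ) : ℕ∞) ≤ P.height) (hpq : p ≤ q) :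
    DepthGE R (d - (q + 1 - p)) (R ⧸ leadingMinors M p q) ∧
      DepthGE R (d - (q + 1 - p)) ((Fin p → R) ⧸ columnSpan M p q) := by
  -- For square blocks the height bound is `1`, which the zero prime violates.
  have hdet : ∀ p' ≤ p, (block M p' p').det ≠ 0 := by
    intro p' hp'
    apply det_block_ne_zero
    intro h0
    have := hH p' hp' p' (by omega) le_rfl ⊥ Ideal.isPrime_bot h0.le
    simp at this
  induction p generalizing q with
  | zero =>
    have : Subsingleton (R ⧸ leadingMinors M 0 q) := by
      rw [leadingMinors_zero]
      infer_instance
    exact ⟨.of_subsingleton _, .of_subsingleton _⟩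
  | succ p ih =>
    have ih' := fun q' (hq' : q' ≤ q) (hpq' : p ≤ q') => ih (q := q')
      (fun p' h1 q'' h2 h3 => hH p' (by omega) q'' (by omega) h3) hpq'
      (fun p' h => hdet p' (by omega))
    -- The annihilator of the last unit vector in `C(p+1,q')` is `I(p+1,q')`: a vector `b` with
    -- image `a` times that unit vector is a relation for the first `p` rows, and pairing it with
    -- row `p` gives `a`.
    have step : ∀ q' ≤ q, p + 1 ≤ q' →
        DepthGE R (d - (q' + 1 - (p + 1))) ((Fin (p + 1) → R) ⧸ columnSpan M (p + 1) q') →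
        DepthGE R (d - (q' + 1 - (p + 1))) (R ⧸ leadingMinors M (p + 1) q') := by
      intro q' hq' hpq' hC
      have hI : ∀ a : R, a • (Pi.single (Fin.last p) 1 : Fin (p + 1) → R) ∈
          columnSpan M (p + 1) q' ↔ a ∈ leadingMinors M (p + 1) q' := by
        refine fun a => ⟨fun ha => ?_, fun ha => smul_mem_columnSpan M ha _⟩
        obtain ⟨b, hb⟩ := mem_columnSpan.mp ha
        have h1 := sum_mem_appendedMinors M (p := p) (q := q') (by omega) (hdet p (by omega))
          (fun q'' h h' => mem_leadingMinors_of_smul_mem hdim M h (ih' q'' (by omega) h).1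
            (fun P hP hle => hH p (by omega) (q'' + 1) (by omega) (by omega) P hP hle)) b
          (fun i => by simpa using hb i.castSucc) (M p)
        have h2 := hb (Fin.last p)
        simp only [Fin.val_last, Pi.smul_apply, Pi.single_eq_same, smul_eq_mul, mul_one] at h2
        rwa [h2, appendedMinors, Function.update_eq_self] at h1
      rcases Nat.eq_zero_or_pos (d - (q' + 1 - (p + 1))) with h0 | hpos
      · rw [h0]
        exact depthGE_zero
      obtain ⟨e, he⟩ := Nat.exists_eq_add_one.mpr hpos
      rw [he] at hC ⊢
      refine DepthGE.quotient_ideal hI hC ?_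
      exact (((ih' q' hq' (by omega)).2).mono (by omega)).congr (cokernelSuccEquiv M p q').symm
    clear ih
    suffices h : DepthGE R (d - (q + 1 - (p + 1))) ((Fin (p + 1) → R) ⧸ columnSpan M (p + 1) q) from
      ⟨step q le_rfl hpq h, h⟩
    induction q, hpq using Nat.le_induction with
    | base =>
      rcases Nat.eq_zero_or_pos d with rfl | hpos
      · rw [Nat.zero_sub]
        exact depthGE_zero
      -- A square matrix with nonzero determinant is injective, so its cokernel has a free
      -- resolution of length one.
      refine DepthGE.of_exact_right (f := (block M (p + 1) (p + 1)).mulVecLin)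
        (g := (columnSpan M (p + 1) (p + 1)).mkQ) ?_ ?_ (Submodule.mkQ_surjective _)
        (depthGE_pi (hd.mono (by omega))) (depthGE_pi (hd.mono (by omega)))
      · rw [LinearMap.exact_iff, Submodule.ker_mkQ]
        rfl
      · rw [← LinearMap.ker_eq_bot, LinearMap.ker_eq_bot']
        exact fun b hb => Matrix.eq_zero_of_mulVec_eq_zero (hdet _ le_rfl) hb
    | succ q hpq ihq =>
      have hC := ihq (fun p' h1 q' h2 h3 => hH p' h1 q' (by omega) h3)
        (fun q' h1 h2 => ih' q' (by omega) h2) (fun q' h1 h2 => step q' (by omega) h2)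
      have hI := step q (by omega) hpq hC
      rcases Nat.eq_zero_or_pos (d - (q + 1 + 1 - (p + 1))) with h0 | hpos
      · rw [h0]
        exact depthGE_zero
      rw [columnSpan_succ]
      refine DepthGE.quotient_sup_span (I := leadingMinors M (p + 1) q)
        (fun a => ⟨fun ha => ?_, fun ha => smul_mem_columnSpan M ha _⟩) (hI.mono (by omega))
        (hC.mono (by omega))
      exact mem_leadingMinors_of_smul_mem hdim M hpq hI
        (fun P hP hle => hH (p + 1) le_rfl (q + 1) le_rfl (by omega) P hP hle) a ha

end DepthOfMinors

/-! ### Specialising a row relation through a valuation ring -/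

section HeightBound

/-- Independent rows would give rank `p`, hence `p` independent columns and a nonzero maximal minor.
-/
theorem exists_vecMul_eq_zero {K : Type*} [Field K] {p q : ℕ} (A : Matrix (Fin p) (Fin q) K)
    (h : ∀ f : Fin p → Fin q, (A.submatrix id f).det = 0) : ∃ c ≠ 0, c ᵥ* A = 0 := by
  by_contra! hcon
  have hli : LinearIndependent K A.row := by
    rw [← Matrix.vecMul_injective_iff]
    intro c d hcd
    by_contra hne
    exact hcon (c - d) (sub_ne_zero.mpr hne) (by rw [Matrix.sub_vecMul]; exact sub_eq_zero.mpr hcd)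
  have hrank := hli.rank_matrix
  rw [Fintype.card_fin, Matrix.rank_eq_finrank_span_cols] at hrank
  obtain ⟨g, hg, -, hgl⟩ := Submodule.exists_fun_fin_finrank_span_eq K (Set.range A.col)
  choose f hf using hg
  have h1 : LinearIndependent K ((A.submatrix id (f ∘ Fin.cast hrank.symm)).col) := by
    convert! hgl.comp (Fin.cast hrank.symm) (Fin.cast_injective _) using 1
    ext j i
    exact congrFun (hf _) i
  rw [Matrix.linearIndependent_cols_iff_isUnit, Matrix.isUnit_iff_isUnit_det, h] at h1
  exact not_isUnit_zero h1

/-- Over the local ring of a prime `P ≤ 𝔪` that contains the maximal minors of `A`, a relation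
between the rows of `A` can be normalised in a valuation ring that dominates the local ring of
`S ⧸ P` at `𝔪`. -/
theorem exists_valuation_relation {S : Type u} [CommRing S] {p q : ℕ}
    (A : Matrix (Fin p) (Fin q) S) {P 𝔪 : Ideal S} [hP : P.IsPrime] [h𝔪 : 𝔪.IsPrime]
    (hle : P ≤ 𝔪) (hA : ∀ f : Fin p → Fin q, (A.submatrix id f).det ∈ P) :
    ∃ (B : Type u) (_ : CommRing B) (_ : IsDomain B) (_ : IsLocalRing B) (g : S →+* B)
      (c : Fin p → B) (i₀ : Fin p), RingHom.ker g = P ∧ (∀ s ∈ 𝔪, g s ∈ maximalIdeal B) ∧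
      c i₀ = 1 ∧ (∀ j, ∑ i, c i * g (A i j) = 0) ∧
      ∃ s ∉ P, ∀ i, ∃ a, g s * c i = g a := by
  let K := FractionRing (S ⧸ P)
  let π : S →+* K := (algebraMap (S ⧸ P) K).comp (Ideal.Quotient.mk P)
  have hπ : ∀ s, π s = 0 ↔ s ∈ P := by
    intro s
    rw [← Ideal.Quotient.eq_zero_iff_mem, RingHom.comp_apply,
      map_eq_zero_iff _ (IsFractionRing.injective (S ⧸ P) K)]
  obtain ⟨c, hc0, hc⟩ := exists_vecMul_eq_zero (A.map π) (fun f => by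
    rw [← (hπ _).mpr (hA f), RingHom.map_det]
    rfl)
  let φ : Localization.AtPrime 𝔪 →+* K := IsLocalization.lift (M := 𝔪.primeCompl) (g := π) (by
    rintro ⟨s, hs⟩
    rw [isUnit_iff_ne_zero, Ne, hπ]
    exact fun h => hs (hle h))
  obtain ⟨V, hV, hloc⟩ := IsLocalRing.exists_factor_valuationRing φ
  have hφ : ∀ s, φ (algebraMap _ _ s) = π s := fun s => IsLocalization.lift_eq _ s
  obtain ⟨i₁, hi₁⟩ := Function.ne_iff.mp hc0
  have : Nonempty (Fin p) := ⟨i₁⟩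
  -- Dividing by the coefficient of largest value makes all coefficients integral and one of them
  -- `1`.
  obtain ⟨i₀, hi₀⟩ := Finite.exists_max fun i => V.valuation (c i)
  have hci₀ : c i₀ ≠ 0 := by
    intro h0
    have := hi₀ i₁
    rw [h0, map_zero, le_zero_iff, map_eq_zero] at this
    exact hi₁ this
  have hmem : ∀ i, c i / c i₀ ∈ V := by
    intro i
    rw [← V.valuation_le_one_iff, map_div₀]
    exact div_le_one_of_le₀ (hi₀ i) zero_le
  let g : S →+* V := (φ.codRestrict V.toSubring hV).comp (algebraMap S (Localization.AtPrime 𝔪))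
  have hg : ∀ s, ((g s : V) : K) = π s := hφ
  refine ⟨V, inferInstance, inferInstance, inferInstance, g, fun i => ⟨c i / c i₀, hmem i⟩, i₀,
    ?_, ?_, ?_, ?_, ?_⟩
  · ext s
    rw [RingHom.mem_ker, ← hπ, ← hg s]
    exact Subtype.ext_iff
  · intro s hs
    rw [mem_maximalIdeal, mem_nonunits_iff]
    intro hu
    have h1 : IsUnit (algebraMap S (Localization.AtPrime 𝔪) s) := hloc.map_nonunit _ hu
    exact (IsLocalization.AtPrime.isUnit_to_map_iff (Localization.AtPrime 𝔪) 𝔪 s).mp h1 hs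
  · exact Subtype.ext (div_self hci₀)
  · intro j
    apply Subtype.ext
    have h1 := congrFun hc j
    simp only [Matrix.vecMul, dotProduct, Matrix.map_apply, Pi.zero_apply] at h1
    push_cast
    simp only [hg]
    calc ∑ i, c i / c i₀ * π (A i j) = (∑ i, c i * π (A i j)) / c i₀ := by
          rw [Finset.sum_div]
          exact Finset.sum_congr rfl fun i _ => by ring
      _ = 0 := by rw [h1, zero_div]
  -- A common denominator `s` shows that the coefficients are rational functions on `V(P)`.
  · obtain ⟨b, hb⟩ := IsLocalization.exist_integer_multiples_of_finite (nonZeroDivisors (S ⧸ P))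
      (fun i => c i / c i₀)
    obtain ⟨s, hs⟩ := Ideal.Quotient.mk_surjective (b : S ⧸ P)
    refine ⟨s, ?_, fun i => ?_⟩
    · rw [← Ideal.Quotient.eq_zero_iff_mem, hs]
      exact nonZeroDivisors.ne_zero b.2
    · obtain ⟨a, ha⟩ := hb i
      obtain ⟨a, rfl⟩ := Ideal.Quotient.mk_surjective a
      refine ⟨a, Subtype.ext ?_⟩
      push_cast
      rw [hg, hg]
      change algebraMap (S ⧸ P) K (Ideal.Quotient.mk P s) * _ = _
      rw [hs]
      refine Eq.trans ?_ ha.symm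
      rw [Algebra.smul_def]

end HeightBound

/-! ### Dimension of the graph and of its fibre -/

section HeightBound

theorem isLocalizationAtPrime_quotient {S : Type*} [CommRing S] {J 𝔪 : Ideal S} [h𝔪 : 𝔪.IsPrime]
    (hJ : J ≤ 𝔪) [(𝔪.map (Ideal.Quotient.mk J)).IsPrime] :
    IsLocalization.AtPrime (Localization.AtPrime 𝔪 ⧸ J.map (algebraMap S (Localization.AtPrime 𝔪)))
      (𝔪.map (Ideal.Quotient.mk J)) := by
  have h1 : (𝔪.map (Ideal.Quotient.mk J)).primeCompl =
      Algebra.algebraMapSubmonoid (S ⧸ J) 𝔪.primeCompl := by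
    ext x
    obtain ⟨x, rfl⟩ := Ideal.Quotient.mk_surjective x
    have h2 : Ideal.Quotient.mk J x ∈ 𝔪.map (Ideal.Quotient.mk J) ↔ x ∈ 𝔪 := by
      rw [← Ideal.mem_comap, Ideal.comap_map_of_surjective _ Ideal.Quotient.mk_surjective,
        ← RingHom.ker_eq_comap_bot, Ideal.mk_ker, sup_eq_left.mpr hJ]
    rw [Ideal.mem_primeCompl_iff, h2]
    constructor
    · exact fun hx => ⟨x, hx, rfl⟩
    · rintro ⟨y, hy, hxy⟩ hx
      apply hy
      have : Ideal.Quotient.mk J y = Ideal.Quotient.mk J x := hxy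
      have h3 := 𝔪.add_mem (hJ (Ideal.Quotient.eq.mp this)) hx
      simpa using h3
  rw [IsLocalization.AtPrime, h1]
  infer_instance

/-- Each member of a regular sequence lowers the dimension of the local ring by exactly one. -/
theorem height_add_length_le {S : Type*} [CommRing S] [IsNoetherianRing S] {𝔪 : Ideal S}
    [h𝔪 : 𝔪.IsPrime] (l : List S)
    (hl : RingTheory.Sequence.IsRegular (Localization.AtPrime 𝔪)
      (l.map (algebraMap S (Localization.AtPrime 𝔪)))) :
    Ideal.ofList l ≤ 𝔪 ∧
      (𝔪.map (Ideal.Quotient.mk (Ideal.ofList l))).height + l.length = 𝔪.height := by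
  have hle : Ideal.ofList l ≤ 𝔪 := by
    have h1 := hl.top_ne_smul
    rw [smul_eq_mul, Ideal.mul_top, ← Ideal.map_ofList] at h1
    intro x hx
    by_contra hxm
    exact h1 (Ideal.eq_top_of_isUnit_mem _ (Ideal.mem_map_of_mem _ hx)
      ((IsLocalization.AtPrime.isUnit_to_map_iff _ 𝔪 x).mpr hxm)).symm
  refine ⟨hle, ?_⟩
  have hp : (𝔪.map (Ideal.Quotient.mk (Ideal.ofList l))).IsPrime :=
    Ideal.isPrime_map_quotientMk_of_isPrime hle
  have := isLocalizationAtPrime_quotient hle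
  have h2 := ringKrullDim_add_length_eq_ringKrullDim_of_isRegular _ hl
  rw [← Ideal.map_ofList, IsLocalization.AtPrime.ringKrullDim_eq_height 𝔪 (Localization.AtPrime 𝔪),
    IsLocalization.AtPrime.ringKrullDim_eq_height (𝔪.map (Ideal.Quotient.mk (Ideal.ofList l)))
      (Localization.AtPrime 𝔪 ⧸ (Ideal.ofList l).map (algebraMap S (Localization.AtPrime 𝔪))),
    List.length_map] at h2
  exact_mod_cast h2

variable {k : Type u} [Field k] {σ τ : Type}

theorem exists_pow_mul_sub_rename_mem {Q : Ideal (MvPolynomial (τ ⊕ σ) k)} {s : MvPolynomial σ k}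
    {a : τ → MvPolynomial σ k}
    (h : ∀ i, MvPolynomial.rename Sum.inr s * MvPolynomial.X (Sum.inl i) -
      MvPolynomial.rename Sum.inr (a i) ∈ Q) (f : MvPolynomial (τ ⊕ σ) k) :
    ∃ (N : ℕ) (g : MvPolynomial σ k),
      MvPolynomial.rename Sum.inr s ^ N * f - MvPolynomial.rename Sum.inr g ∈ Q := by
  induction f using MvPolynomial.induction_on with
  | C c => exact ⟨0, MvPolynomial.C c, by simp⟩
  | add f₁ f₂ h₁ h₂ =>
    obtain ⟨N₁, g₁, h₁⟩ := h₁
    obtain ⟨N₂, g₂, h₂⟩ := h₂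
    refine ⟨N₁ + N₂, s ^ N₂ * g₁ + s ^ N₁ * g₂, ?_⟩
    have := Q.add_mem (Q.mul_mem_left (MvPolynomial.rename Sum.inr s ^ N₂) h₁)
      (Q.mul_mem_left (MvPolynomial.rename Sum.inr s ^ N₁) h₂)
    convert! this using 1
    simp only [map_add, map_mul, map_pow]
    ring
  | mul_X f i hf =>
    obtain ⟨N, g, hf⟩ := hf
    cases i with
    | inl i =>
      refine ⟨N + 1, g * a i, ?_⟩
      have := Q.add_mem (Q.mul_mem_left (MvPolynomial.rename Sum.inr s *
        MvPolynomial.X (Sum.inl i)) hf) (Q.mul_mem_left (MvPolynomial.rename Sum.inr g) (h i))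
      convert! this using 1
      simp only [map_mul]
      ring
    | inr i =>
      refine ⟨N, g * MvPolynomial.X i, ?_⟩
      have := Q.mul_mem_left (MvPolynomial.X (Sum.inr i)) hf
      convert! this using 1
      simp only [map_mul, MvPolynomial.rename_X]
      ring

/-- Where `s ≠ 0`, the set `V(P₀)` is the graph of `y_i = a_i / s` over `V(P)`. Hence `P₀` is
minimal over `height P` elements of `P` together with the equations `s y_i - a_i`, and Krull's
height theorem applies. -/
theorem height_le_add_card [Finite σ] [Fintype τ] {P : Ideal (MvPolynomial σ k)} [hP : P.IsPrime]
    {P₀ : Ideal (MvPolynomial (τ ⊕ σ) k)} [hP₀ : P₀.IsPrime]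
    (hcomap : ∀ g, MvPolynomial.rename Sum.inr g ∈ P₀ ↔ g ∈ P) {s : MvPolynomial σ k}
    (hs : s ∉ P) {a : τ → MvPolynomial σ k}
    (h : ∀ i, MvPolynomial.rename Sum.inr s * MvPolynomial.X (Sum.inl i) -
      MvPolynomial.rename Sum.inr (a i) ∈ P₀) :
    P₀.height ≤ P.height + Fintype.card τ := by
  classical
  let ι : MvPolynomial σ k →ₐ[k] MvPolynomial (τ ⊕ σ) k := MvPolynomial.rename Sum.inr
  obtain ⟨t, ht, htc⟩ := P.exists_finset_card_eq_height_of_isNoetherianRing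
  let t₀ : Finset (MvPolynomial (τ ⊕ σ) k) :=
    t.image ι ∪ Finset.univ.image fun i => ι s * MvPolynomial.X (Sum.inl i) - ι (a i)
  have hmin : P₀ ∈ (Ideal.span (t₀ : Set (MvPolynomial (τ ⊕ σ) k))).minimalPrimes := by
    refine ⟨⟨hP₀, ?_⟩, ?_⟩
    · rw [Ideal.span_le]
      intro x hx
      simp only [t₀, Finset.coe_union, Finset.coe_image, Set.mem_union, Set.mem_image,
        Finset.coe_univ, Set.mem_univ, true_and] at hx
      rcases hx with ⟨y, hy, rfl⟩ | ⟨i, rfl⟩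
      · exact (hcomap y).mpr (ht.1.2 (Ideal.subset_span hy))
      · exact h i
    · rintro Q ⟨hQ, hQt⟩ hQP f hf
      rw [Ideal.span_le] at hQt
      have h1 : P ≤ Q.comap ι := by
        refine ht.2 ⟨Ideal.comap_isPrime ι Q, ?_⟩ fun x hx => (hcomap x).mp (hQP hx)
        rw [Ideal.span_le]
        exact fun y hy => hQt (by simpa [t₀] using Or.inl ⟨y, hy, rfl⟩)
      -- Modulo `Q`, a power of `s` clears the variables `y_i` from `f`, which reduces the claim to
      -- `P`.
      obtain ⟨N, g, hg⟩ := exists_pow_mul_sub_rename_mem (Q := Q) (s := s) (a := a)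
        (fun i => hQt (by simpa [t₀] using Or.inr ⟨i, rfl⟩)) f
      have h2 : ι g ∈ P₀ := by
        have := P₀.sub_mem (P₀.mul_mem_left (ι s ^ N) hf) (hQP hg)
        rwa [sub_sub_cancel] at this
      have h3 : ι g ∈ Q := h1 ((hcomap g).mp h2)
      have h4 : ι s ^ N * f ∈ Q := by
        have := Q.add_mem hg h3
        rwa [sub_add_cancel] at this
      refine (hQ.mem_or_mem h4).resolve_left fun h5 => hs ?_
      exact (hcomap s).mp (hQP (hQ.mem_of_pow_mem N h5))
  refine (Ideal.height_le_card_of_mem_minimalPrimes_span_finset hmin).trans ?_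
  rw [← htc]
  have : t₀.card ≤ t.card + Fintype.card τ :=
    (Finset.card_union_le _ _).trans (add_le_add Finset.card_image_le Finset.card_image_le)
  exact_mod_cast this

/-- If `N` is the point `(c, 𝔪)` of the product of affine spaces, `P₀` is a prime that contains
the coordinate function `X i₀ - c i₀`, and `J` is an ideal of the second factor that vanishes on
the fibre of `V(P₀)` over `c`, the dimension of `V(P₀)` at `N` is bounded by that of `V(J)` at `𝔪`
plus the number of the remaining coordinates. -/
theorem height_map_quotient_le [Finite σ] [Fintype τ] [DecidableEq τ]
    {𝔪 J : Ideal (MvPolynomial σ k)} [h𝔪 : 𝔪.IsPrime] (hJ : J ≤ 𝔪)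
    {N P₀ : Ideal (MvPolynomial (τ ⊕ σ) k)}
    [hN : N.IsPrime] (hP₀N : P₀ ≤ N)
    (hcomap : ∀ g, MvPolynomial.rename Sum.inr g ∈ N ↔ g ∈ 𝔪) (c : τ → k) (i₀ : τ)
    (hc : ∀ i, MvPolynomial.X (Sum.inl i) - MvPolynomial.C (c i) ∈ N)
    (hi₀ : MvPolynomial.X (Sum.inl i₀) - MvPolynomial.C (c i₀) ∈ P₀)
    (hJP : ∀ Q : Ideal (MvPolynomial (τ ⊕ σ) k), P₀ ≤ Q →
      (∀ i, MvPolynomial.X (Sum.inl i) - MvPolynomial.C (c i) ∈ Q) →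
      ∀ x ∈ J, MvPolynomial.rename Sum.inr x ∈ Q) :
    (N.map (Ideal.Quotient.mk P₀)).height + 1 ≤
      (𝔪.map (Ideal.Quotient.mk J)).height + Fintype.card τ := by
  classical
  let ι : MvPolynomial σ k →ₐ[k] MvPolynomial (τ ⊕ σ) k := MvPolynomial.rename Sum.inr
  have hp : (𝔪.map (Ideal.Quotient.mk J)).IsPrime := Ideal.isPrime_map_quotientMk_of_isPrime hJ
  have hpN : (N.map (Ideal.Quotient.mk P₀)).IsPrime := Ideal.isPrime_map_quotientMk_of_isPrime hP₀N
  obtain ⟨t, ht, htc⟩ :=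
    (𝔪.map (Ideal.Quotient.mk J)).exists_finset_card_eq_height_of_isNoetherianRing
  let lift : MvPolynomial σ k ⧸ J → MvPolynomial σ k :=
    Function.surjInv Ideal.Quotient.mk_surjective
  have hlift : ∀ y, Ideal.Quotient.mk J (lift y) = y :=
    Function.surjInv_eq Ideal.Quotient.mk_surjective
  have hmem𝔪 : ∀ x, Ideal.Quotient.mk J x ∈ 𝔪.map (Ideal.Quotient.mk J) ↔ x ∈ 𝔪 := fun x => by
    rw [← Ideal.mem_comap, Ideal.comap_map_of_surjective _ Ideal.Quotient.mk_surjective,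
        ← RingHom.ker_eq_comap_bot, Ideal.mk_ker, sup_eq_left.mpr hJ]
  -- Lifts of parameters for `𝔪/J`, together with the functions `y_i - c_i`. The index `i₀` is
  -- omitted because that function already vanishes modulo `P₀`; this saves the one in the bound.
  let t₀ : Finset (MvPolynomial (τ ⊕ σ) k ⧸ P₀) :=
    t.image (fun y => Ideal.Quotient.mk P₀ (ι (lift y))) ∪ (Finset.univ.erase i₀).image
      fun i => Ideal.Quotient.mk P₀ (MvPolynomial.X (Sum.inl i) - MvPolynomial.C (c i))
  have hmin : N.map (Ideal.Quotient.mk P₀) ∈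
      (Ideal.span (t₀ : Set (MvPolynomial (τ ⊕ σ) k ⧸ P₀))).minimalPrimes := by
    refine ⟨⟨hpN, ?_⟩, ?_⟩
    · rw [Ideal.span_le]
      intro x hx
      simp only [t₀, Finset.coe_union, Finset.coe_image, Set.mem_union, Set.mem_image,
        SetLike.mem_coe] at hx
      rcases hx with ⟨y, hy, rfl⟩ | ⟨i, hi, rfl⟩
      · refine Ideal.mem_map_of_mem _ ((hcomap _).mpr ((hmem𝔪 _).mp ?_))
        rw [hlift]
        exact ht.1.2 (Ideal.subset_span hy)
      · exact Ideal.mem_map_of_mem _ (hc i)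
    · rintro Q' ⟨hQ', hQt⟩ hQN
      rw [Ideal.span_le] at hQt
      set Q := Q'.comap (Ideal.Quotient.mk P₀) with hQdef
      have hQ : Q.IsPrime := Ideal.comap_isPrime _ _
      have hP₀Q : P₀ ≤ Q := fun x hx => by
        rw [hQdef, Ideal.mem_comap, Ideal.Quotient.eq_zero_iff_mem.mpr hx]
        exact zero_mem _
      have hQN' : Q ≤ N := by
        refine (Ideal.comap_mono hQN).trans ?_
        rw [Ideal.comap_map_of_surjective _ Ideal.Quotient.mk_surjective,
          ← RingHom.ker_eq_comap_bot, Ideal.mk_ker, sup_eq_left.mpr hP₀N]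
      have hcQ : ∀ i, MvPolynomial.X (Sum.inl i) - MvPolynomial.C (c i) ∈ Q := by
        intro i
        rcases eq_or_ne i i₀ with rfl | hne
        · exact hP₀Q hi₀
        · exact hQt (by
            rw [Finset.mem_coe, Finset.mem_union]
            exact Or.inr (Finset.mem_image_of_mem _ (by simpa using hne)))
      have hJQ : J ≤ Q.comap ι := fun x hx => hJP Q hP₀Q hcQ x hx
      have h𝔪Q : 𝔪 ≤ Q.comap ι := by
        have hQι : (Q.comap ι).IsPrime := Ideal.comap_isPrime ι Q
        have h1 : 𝔪.map (Ideal.Quotient.mk J) ≤ (Q.comap ι).map (Ideal.Quotient.mk J) := by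
          refine ht.2 ⟨Ideal.isPrime_map_quotientMk_of_isPrime hJQ, ?_⟩
            (Ideal.map_mono fun x hx => (hcomap x).mp (hQN' hx))
          rw [Ideal.span_le]
          intro y hy
          rw [← hlift y]
          refine Ideal.mem_map_of_mem _ (hQt ?_)
          rw [Finset.mem_coe, Finset.mem_union]
          exact Or.inl (Finset.mem_image_of_mem _ hy)
        intro x hx
        have h2 := h1 (Ideal.mem_map_of_mem _ hx)
        rw [← Ideal.mem_comap, Ideal.comap_map_of_surjective _ Ideal.Quotient.mk_surjective,
          ← RingHom.ker_eq_comap_bot, Ideal.mk_ker, sup_eq_left.mpr hJQ] at h2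
        exact h2
      rw [Ideal.map_le_iff_le_comap]
      intro f hf
      have hone : ∀ f : MvPolynomial (τ ⊕ σ) k, f - ι (MvPolynomial.aeval
          (Sum.elim (fun i => MvPolynomial.C (c i)) MvPolynomial.X) f) ∈ Q := by
        intro f
        rw [← Ideal.Quotient.eq_zero_iff_mem, map_sub, sub_eq_zero]
        have : (Ideal.Quotient.mkₐ k Q) = ((Ideal.Quotient.mkₐ k Q).comp ι).comp
            (MvPolynomial.aeval (Sum.elim (fun i => MvPolynomial.C (c i)) MvPolynomial.X)) := by
          ext i
          cases i with
          | inl i =>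
            have := Ideal.Quotient.eq_zero_iff_mem.mpr (hcQ i)
            rw [map_sub, sub_eq_zero] at this
            simpa [ι] using this
          | inr i => simp [ι]
        exact DFunLike.congr_fun this f
      have h3 := N.sub_mem hf (hQN' (hone f))
      rw [sub_sub_cancel] at h3
      have h4 := Q.add_mem (hone f) (h𝔪Q ((hcomap _).mp h3))
      rw [sub_add_cancel] at h4
      exact h4
  refine (add_le_add_left (Ideal.height_le_card_of_mem_minimalPrimes_span_finset hmin) 1).trans ?_
  rw [← htc]
  have h1 : t₀.card ≤ t.card + (Fintype.card τ - 1) := by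
    refine (Finset.card_union_le _ _).trans (add_le_add Finset.card_image_le
      (Finset.card_image_le.trans ?_))
    rw [Finset.card_erase_of_mem (Finset.mem_univ _), Finset.card_univ]
  have h2 : 0 < Fintype.card τ := Fintype.card_pos_iff.mpr ⟨i₀⟩
  have h3 : t₀.card + 1 ≤ t.card + Fintype.card τ := by omega
  exact_mod_cast h3

end HeightBound

/-! ### The height bound at the origin -/

section PseudoOneGeneric

variable {k : Type u} [Field k] {n p q : ℕ}

theorem mem_idealOfVars_iff_constantCoeff_eq_zero (f : MvPolynomial (Fin (n + 1)) k) :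
    f ∈ MvPolynomial.idealOfVars (Fin (n + 1)) k ↔ MvPolynomial.constantCoeff f = 0 := by
  have h1 := MvPolynomial.mem_pow_idealOfVars_iff (σ := Fin (n + 1)) (R := k) 1 f
  rw [pow_one] at h1
  rw [h1, MvPolynomial.constantCoeff_eq]
  constructor
  · intro h
    by_contra hc
    have := h 0 (by simpa using hc)
    simp at this
  · intro h x hx
    rw [Nat.one_le_iff_ne_zero, Ne, Finsupp.degree_eq_zero_iff]
    rintro rfl
    simp [h] at hx

instance isMaximal_idealOfVars : (MvPolynomial.idealOfVars (Fin (n + 1)) k).IsMaximal := by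
  have h : MvPolynomial.idealOfVars (Fin (n + 1)) k =
      RingHom.ker (MvPolynomial.constantCoeff (σ := Fin (n + 1)) (R := k)) := by
    ext f
    rw [mem_idealOfVars_iff_constantCoeff_eq_zero, RingHom.mem_ker]
  rw [h]
  exact RingHom.ker_isMaximal_of_surjective _ fun c => ⟨MvPolynomial.C c, by simp⟩

variable [IsAlgClosed k]

theorem le_height_of_isPseudoOneGeneric {M : Matrix (Fin p) (Fin q) (MvPolynomial (Fin (n + 1)) k)}
    (hM : IsPseudoOneGeneric M) {P : Ideal (MvPolynomial (Fin (n + 1)) k)}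
    [hP : P.IsPrime] (hle : P ≤ MvPolynomial.idealOfVars (Fin (n + 1)) k)
    (hdet : ∀ f : Fin p → Fin q, (M.submatrix id f).det ∈ P) :
    ((q + 1 - p : ℕ) : ℕ∞) ≤ P.height := by
  classical
  obtain ⟨B, _, _, _, g, c, i₀, hker, hg𝔪, hci₀, hcM, s, hs, hsc⟩ :=
    exists_valuation_relation M hle hdet
  choose a ha using hsc
  -- The kernel of `Φ` is the prime of the closure of the graph of the relation `c` over `V(P)`.
  let Φ : MvPolynomial (Fin p ⊕ Fin (n + 1)) k →+* B :=
    MvPolynomial.eval₂Hom (g.comp MvPolynomial.C) (Sum.elim c (g ∘ MvPolynomial.X))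
  have hΦg : ∀ f, Φ (MvPolynomial.rename Sum.inr f) = g f := by
    intro f
    have : Φ.comp (MvPolynomial.rename Sum.inr : MvPolynomial (Fin (n + 1)) k →ₐ[k]
        MvPolynomial (Fin p ⊕ Fin (n + 1)) k).toRingHom = g := by
      ext <;> simp [Φ]
    exact DFunLike.congr_fun this f
  have hΦc : ∀ i, Φ (MvPolynomial.X (Sum.inl i)) = c i := fun i => by simp [Φ]
  let P₀ := RingHom.ker Φ
  have hP₀ : P₀.IsPrime := RingHom.ker_isPrime Φ
  -- The residue field of `B` may exceed `k`, so the preimage of its maximal ideal need not be a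
  -- closed point. Any closed point `N` in its closure still lies over the origin, since `𝔪` is
  -- maximal.
  obtain ⟨N, hN, hNle⟩ := Ideal.exists_le_maximal ((maximalIdeal B).comap Φ)
    (Ideal.comap_isPrime Φ _).ne_top
  have hP₀N : P₀ ≤ N := fun x hx => hNle (by
    rw [Ideal.mem_comap, (RingHom.mem_ker (f := Φ)).mp hx]; exact zero_mem _)
  have hcomapN : ∀ f, MvPolynomial.rename Sum.inr f ∈ N ↔
      f ∈ MvPolynomial.idealOfVars (Fin (n + 1)) k := by
    have h1 := isMaximal_idealOfVars (k := k) (n := n).eq_of_le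
      (J := N.comap (MvPolynomial.rename Sum.inr)) (Ideal.comap_isPrime _ N).ne_top
      fun f hf => hNle (by rw [Ideal.mem_comap, hΦg]; exact hg𝔪 f hf)
    intro f
    rw [h1, Ideal.mem_comap]
  obtain ⟨x, hx⟩ := MvPolynomial.isMaximal_iff_eq_vanishingIdeal_singleton.mp hN
  let c₀ : Fin p → k := fun i => x (Sum.inl i)
  have hc₀ : ∀ i, MvPolynomial.X (Sum.inl i) - MvPolynomial.C (c₀ i) ∈ N := fun i => by
    rw [hx, MvPolynomial.mem_vanishingIdeal_singleton_iff]
    simp [c₀]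
  have hi₀ : MvPolynomial.X (Sum.inl i₀) - 1 ∈ P₀ := by
    simp [P₀, RingHom.mem_ker, hΦc, hci₀]
  have hc₀i₀ : c₀ i₀ = 1 := by
    have h1 := hP₀N hi₀
    rw [hx, MvPolynomial.mem_vanishingIdeal_singleton_iff] at h1
    simpa [sub_eq_zero] using h1
  let l : List (MvPolynomial (Fin (n + 1)) k) := List.ofFn (generalizedRow M c₀)
  have hreg := hM c₀ fun h => by simp [h] at hc₀i₀
  have hl := height_add_length_le (𝔪 := MvPolynomial.idealOfVars (Fin (n + 1)) k) l
    (by rwa [List.map_ofFn])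
  have hJP : ∀ Q : Ideal (MvPolynomial (Fin p ⊕ Fin (n + 1)) k), P₀ ≤ Q →
      (∀ i, MvPolynomial.X (Sum.inl i) - MvPolynomial.C (c₀ i) ∈ Q) →
      ∀ x ∈ Ideal.ofList l, MvPolynomial.rename Sum.inr x ∈ Q := by
    intro Q hQ hcQ
    have : Ideal.ofList l ≤ Q.comap (MvPolynomial.rename Sum.inr) := by
      rw [Ideal.ofList, Ideal.span_le]
      intro y hy
      obtain ⟨j, rfl⟩ := (List.mem_ofFn' _ _).mp hy
      have h1 : ∑ i, MvPolynomial.X (Sum.inl i) * MvPolynomial.rename Sum.inr (M i j) ∈ Q :=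
        hQ (by rw [RingHom.mem_ker, map_sum, ← hcM j]; simp only [map_mul, hΦc, hΦg])
      have h2 : ∑ i, (MvPolynomial.X (Sum.inl i) - MvPolynomial.C (c₀ i)) *
          MvPolynomial.rename Sum.inr (M i j) ∈ Q :=
        Q.sum_mem fun i _ => Q.mul_mem_right _ (hcQ i)
      have h3 := Q.sub_mem h1 h2
      rw [← Finset.sum_sub_distrib] at h3
      simp only [← sub_mul, sub_sub_cancel] at h3
      rw [SetLike.mem_coe, Ideal.mem_comap, generalizedRow, map_sum]
      simpa using h3
    exact fun x hx => this hx
  -- With `D` the height of `N/P₀` and `δ` that of `𝔪` modulo the row ideal: `p + n + 1 ≤ ht P₀ +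
  -- D`, `ht P₀ ≤ ht P + p`, `D + 1 ≤ δ + p` and `δ + q = n + 1`. Together they give `ht P ≥ q + 1 -
  -- p`.
  have e1 := card_le_height_add_height hP₀N
  have e2 := height_le_add_card (P := P) (P₀ := P₀) (s := s) (a := a)
    (fun f => by rw [RingHom.mem_ker, hΦg, ← RingHom.mem_ker, hker]) hs
    (fun i => by rw [RingHom.mem_ker, map_sub, map_mul, hΦg, hΦc, hΦg, ha, sub_self])
  have e3 := height_map_quotient_le hl.1 hP₀N hcomapN c₀ i₀ hc₀ (by simpa [hc₀i₀] using hi₀) hJP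
  have e4 := hl.2
  rw [height_eq_card_of_isMaximal, List.length_ofFn] at e4
  simp only [Fintype.card_sum, Fintype.card_fin] at e1 e2 e3 e4
  have hPtop : P.height ≠ ⊤ := Ideal.height_ne_top hP.ne_top
  have hP₀top : P₀.height ≠ ⊤ := Ideal.height_ne_top hP₀.ne_top
  generalize P.height = x1 at *
  generalize P₀.height = x2 at *
  generalize (Ideal.map (Ideal.Quotient.mk P₀) N).height = x3 at *
  generalize (Ideal.map (Ideal.Quotient.mk (Ideal.ofList l)) _).height = x4 at *
  have hx4 : x4 ≠ ⊤ := by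
    rintro rfl
    rw [top_add] at e4
    exact ENat.natCast_ne_top (n + 1) e4.symm
  have hx3 : x3 ≠ ⊤ := by
    rintro rfl
    lift x4 to ℕ using hx4
    rw [top_add, top_le_iff] at e3
    exact ENat.natCast_ne_top _ e3
  lift x1 to ℕ using hPtop
  lift x2 to ℕ using hP₀top
  lift x3 to ℕ using hx3
  lift x4 to ℕ using hx4
  norm_cast at *
  omega

end PseudoOneGeneric

/-! ### Finite matrices as leading blocks -/

section ExtendByZero

variable {R : Type u} [CommRing R] {p q : ℕ}

/-- A finite matrix, regarded as the leading block of an infinite one. -/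
def extendByZero (M : Matrix (Fin p) (Fin q) R) : ℕ → ℕ → R := fun i j =>
  if h : i < p ∧ j < q then M ⟨i, h.1⟩ ⟨j, h.2⟩ else 0

theorem block_extendByZero (M : Matrix (Fin p) (Fin q) R) {p' q' : ℕ} (hp : p' ≤ p) (hq : q' ≤ q) :
    block (extendByZero M) p' q' = M.submatrix (Fin.castLE hp) (Fin.castLE hq) := by
  ext i j
  have : (i : ℕ) < p ∧ (j : ℕ) < q := ⟨by omega, by omega⟩
  simp [block, extendByZero, this]
  rfl

/-- Arbitrary column choices give no new minors: a repetition gives zero, and sorting changes only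
the sign. -/
theorem leadingMinors_extendByZero (M : Matrix (Fin p) (Fin q) R) :
    leadingMinors (extendByZero M) p q = maximalMinors M := by
  rw [leadingMinors, block_extendByZero M le_rfl le_rfl]
  apply le_antisymm
  · rw [Ideal.span_le]
    rintro _ ⟨f, rfl⟩
    change (M.submatrix id f).det ∈ maximalMinors M
    by_cases hf : Function.Injective f
    · have h1 : StrictMono (f ∘ Tuple.sort f) :=
        (Tuple.monotone_sort f).strictMono_of_injective (hf.comp (Tuple.sort f).injective)
      have h2 : (M.submatrix id (f ∘ Tuple.sort f)).det ∈ maximalMinors M :=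
        Ideal.subset_span ⟨OrderEmbedding.ofStrictMono _ h1, rfl⟩
      have h3 := Matrix.det_permute' (Tuple.sort f) (M.submatrix id f)
      rw [Matrix.submatrix_submatrix] at h3
      change (M.submatrix id (f ∘ Tuple.sort f)).det = _ at h3
      rw [h3] at h2
      rcases Int.units_eq_one_or (Equiv.Perm.sign (Tuple.sort f)) with h | h <;>
        simpa [h] using h2
    · rw [Function.not_injective_iff] at hf
      obtain ⟨a, b, hab, hne⟩ := hf
      rw [Matrix.det_zero_of_column_eq hne fun i => by simp [hab]]
      exact zero_mem _
  · exact Ideal.span_mono fun _ ⟨f, hf⟩ => ⟨f, hf⟩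

theorem leadingMinors_map {R' : Type*} [CommRing R'] (g : R →+* R') (M : ℕ → ℕ → R) (p q : ℕ) :
    leadingMinors (fun i j => g (M i j)) p q = (leadingMinors M p q).map g := by
  rw [leadingMinors, leadingMinors, Ideal.map_span, ← Set.range_comp]
  congr 2
  funext f
  rw [Function.comp_apply, RingHom.map_det]
  rfl

end ExtendByZero

/-! ### Height and depth bounds near the origin -/

section LeadingBlocksOfPseudoOneGeneric

variable {k : Type u} [Field k] {n p q : ℕ}

/-- Coefficients are extended by zero to the missing rows; an initial segment of a regular sequence
is regular. -/
theorem IsPseudoOneGeneric.submatrix_castLE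
    {M : Matrix (Fin p) (Fin q) (MvPolynomial (Fin (n + 1)) k)}
    (hM : IsPseudoOneGeneric M) {p' q' : ℕ} (hp : p' ≤ p) (hq : q' ≤ q) :
    IsPseudoOneGeneric (M.submatrix (Fin.castLE hp) (Fin.castLE hq)) := by
  obtain ⟨r, rfl⟩ := Nat.exists_eq_add_of_le hq
  intro c hc
  have hinj := Fin.castLE_injective hp
  let c' : Fin p → k := Function.extend (Fin.castLE hp) c 0
  have hc' : c' ≠ 0 := fun h => hc (funext fun i => by
    have := congrFun h (Fin.castLE hp i)
    rwa [show c' (Fin.castLE hp i) = c i from hinj.extend_apply _ _ _] at this)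
  have hrow : ∀ j, generalizedRow (M.submatrix (Fin.castLE hp) (Fin.castLE hq)) c j =
      generalizedRow M c' (Fin.castAdd r j) := fun j =>
    Fintype.sum_of_injective _ hinj _ _
      (fun i hi => by
        rw [show c' i = 0 from Function.extend_apply' _ _ _ hi, map_zero, zero_mul])
      (fun i => by rw [show c' (Fin.castLE hp i) = c i from hinj.extend_apply _ _ _]; rfl)
  simp only [hrow]
  have h1 := hM c' hc'
  rw [List.ofFn_add] at h1
  refine ⟨(RingTheory.Sequence.isWeaklyRegular_append_iff _ _ _).mp h1.toIsWeaklyRegular |>.1, ?_⟩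
  intro h
  refine h1.top_ne_smul (le_antisymm (h.le.trans (Submodule.smul_mono_left ?_)) le_top)
  rw [Ideal.ofList_append]
  exact le_sup_left

variable [IsAlgClosed k]

theorem le_height_of_leadingMinors_le {M : Matrix (Fin p) (Fin q) (MvPolynomial (Fin (n + 1)) k)}
    (hM : IsPseudoOneGeneric M) {p' q' : ℕ} (hp : p' ≤ p) (hq : q' ≤ q)
    {P : Ideal (MvPolynomial (Fin (n + 1)) k)} [P.IsPrime]
    (hle : P ≤ MvPolynomial.idealOfVars (Fin (n + 1)) k)
    (h : leadingMinors (extendByZero M) p' q' ≤ P) : ((q' + 1 - p' : ℕ) : ℕ∞) ≤ P.height := by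
  refine le_height_of_isPseudoOneGeneric (hM.submatrix_castLE hp hq) hle fun f => h ?_
  rw [← block_extendByZero]
  exact det_mem_leadingMinors _ f

/-- The bound can fail only on components that miss the origin. There are finitely many, over all
blocks, and `F` is a product of functions vanishing on them but not at the origin. -/
theorem exists_notMem_idealOfVars_forall_le_height
    {M : Matrix (Fin p) (Fin q) (MvPolynomial (Fin (n + 1)) k)} (hM : IsPseudoOneGeneric M) :
    ∃ F ∉ MvPolynomial.idealOfVars (Fin (n + 1)) k, ∀ p' ≤ p, ∀ q' ≤ q,
      ∀ P : Ideal (MvPolynomial (Fin (n + 1)) k), P.IsPrime → F ∉ P →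
        leadingMinors (extendByZero M) p' q' ≤ P → ((q' + 1 - p' : ℕ) : ℕ∞) ≤ P.height := by
  classical
  have hfin : ∀ a : ℕ × ℕ, (leadingMinors (extendByZero M) a.1 a.2).minimalPrimes.Finite :=
    fun a => Ideal.finite_minimalPrimes_of_isNoetherianRing _ _
  have hG : ∀ Q : Ideal (MvPolynomial (Fin (n + 1)) k), ∃ g,
      g ∉ MvPolynomial.idealOfVars (Fin (n + 1)) k ∧
      (¬ Q ≤ MvPolynomial.idealOfVars (Fin (n + 1)) k → g ∈ Q) := fun Q => by
    by_cases hQ : Q ≤ MvPolynomial.idealOfVars (Fin (n + 1)) k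
    · exact ⟨1, (Ideal.ne_top_iff_one _).mp isPrime_idealOfVars.ne_top, fun h => absurd hQ h⟩
    · obtain ⟨g, hg, hgm⟩ := SetLike.not_le_iff_exists.mp hQ
      exact ⟨g, hgm, fun _ => hg⟩
  choose G hG𝔪 hGQ using hG
  refine ⟨∏ a ∈ Finset.range (p + 1) ×ˢ Finset.range (q + 1), ∏ Q ∈ (hfin a).toFinset, G Q,
    ?_, ?_⟩
  · rw [Ideal.IsPrime.prod_mem_iff]
    rintro ⟨a, -, ha⟩
    rw [Ideal.IsPrime.prod_mem_iff] at ha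
    obtain ⟨Q, -, hQ⟩ := ha
    exact hG𝔪 Q hQ
  · intro p' hp' q' hq' P hP hF hPle
    obtain ⟨Q, hQ, hQP⟩ := Ideal.exists_minimalPrimes_le hPle
    have hQprime : Q.IsPrime := hQ.1.1
    refine le_trans ?_ (Ideal.height_mono hQP)
    refine le_height_of_leadingMinors_le hM hp' hq' ?_ hQ.1.2
    by_contra hcon
    apply hF
    refine Ideal.mem_of_dvd P (Finset.dvd_prod_of_mem _ (a := (p', q')) ?_)
      (Ideal.mem_of_dvd P (Finset.dvd_prod_of_mem G (a := Q) ?_) (hQP (hGQ Q hcon)))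
    · simp only [Finset.mem_product, Finset.mem_range]
      omega
    · rw [Set.Finite.mem_toFinset]
      exact hQ

theorem depthGE_quotient_map_maximalMinors
    {M : Matrix (Fin p) (Fin q) (MvPolynomial (Fin (n + 1)) k)} (hpq : p ≤ q)
    {F : MvPolynomial (Fin (n + 1)) k} (hF : ∀ p' ≤ p, ∀ q' ≤ q,
      ∀ P : Ideal (MvPolynomial (Fin (n + 1)) k), P.IsPrime → F ∉ P →
        leadingMinors (extendByZero M) p' q' ≤ P → ((q' + 1 - p' : ℕ) : ℕ∞) ≤ P.height)
    (𝔫 : Ideal (MvPolynomial (Fin (n + 1)) k)) [𝔫.IsMaximal] (hF𝔫 : F ∉ 𝔫) :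
    DepthGE (Localization.AtPrime 𝔫) (n + 1 - (q + 1 - p))
      (Localization.AtPrime 𝔫 ⧸
        (maximalMinors M).map (algebraMap _ (Localization.AtPrime 𝔫))) := by
  have h1 := depthGE_localization_mvPolynomial 𝔫
  rw [Fintype.card_fin] at h1
  have h2 : ringKrullDim (Localization.AtPrime 𝔫) ≤ ((n + 1 : ℕ) : ℕ) := by
    rw [IsLocalization.AtPrime.ringKrullDim_eq_height 𝔫, height_eq_card_of_isMaximal 𝔫,
      Fintype.card_fin]
    exact le_rfl
  rw [← leadingMinors_extendByZero, ← leadingMinors_map]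
  refine (depthGE_quotient_leadingMinors h1 h2 _ ?_ hpq).1
  intro p' hp' q' hq' _ P hP hPle
  rw [← IsLocalization.height_under 𝔫.primeCompl]
  refine hF p' hp' q' hq' _ (Ideal.comap_isPrime _ _) (fun h => ?_) ?_
  · exact hP.ne_top (Ideal.eq_top_of_isUnit_mem _ h
      ((IsLocalization.AtPrime.isUnit_to_map_iff _ 𝔫 F).mpr hF𝔫))
  · rw [leadingMinors_map] at hPle
    exact Ideal.map_le_iff_le_comap.mp hPle

end LeadingBlocksOfPseudoOneGeneric

/-- The homogeneous core of `P` is a prime that still contains `I`, so it equals `P` by minimality.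
-/
theorem isHomogeneous_of_mem_minimalPrimes {A σ : Type*} [CommRing A] [SetLike σ A]
    [AddSubmonoidClass σ A] {𝒜 : ℕ → σ} [GradedRing 𝒜] {I P : Ideal A} (hI : I.IsHomogeneous 𝒜)
    (hP : P ∈ I.minimalPrimes) : P.IsHomogeneous 𝒜 := by
  have h1 : P ≤ (P.homogeneousCore 𝒜).toIdeal :=
    hP.2 ⟨hP.1.1.homogeneousCore, by
      rw [← hI.toIdeal_homogeneousCore_eq_self]
      exact Ideal.homogeneousCore_mono 𝒜 hP.1.2⟩ (Ideal.toIdeal_homogeneousCore_le 𝒜 P)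
  rw [le_antisymm h1 (Ideal.toIdeal_homogeneousCore_le 𝒜 P)]
  exact (P.homogeneousCore 𝒜).isHomogeneous

/-! ### The torus action -/

section Torus

variable {k : Type u} [Field k] {n : ℕ} {w : Fin (n + 1) → ℕ}

/-- With positive weights the degree-zero component is the constant term, which would be a unit in
`P` if nonzero. -/
theorem le_idealOfVars_of_isHomogeneous (hw : ∀ i, 0 < w i)
    {P : Ideal (MvPolynomial (Fin (n + 1)) k)} (hP : P.IsHomogeneous (grading k w)) (hne : P ≠ ⊤) :
    P ≤ MvPolynomial.idealOfVars (Fin (n + 1)) k := by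
  intro f hf
  rw [mem_idealOfVars_iff_constantCoeff_eq_zero]
  by_contra hcon
  have h1 := hP 0 hf
  have h2 : (DirectSum.decompose (grading k w) f 0 : MvPolynomial (Fin (n + 1)) k) =
      MvPolynomial.weightedHomogeneousComponent w 0 f := by
    exact MvPolynomial.weightedDecomposition.decompose'_apply k w f 0
  rw [h2, MvPolynomial.weightedHomogeneousComponent_zero f fun i => (hw i).ne'] at h1
  refine hne (Ideal.eq_top_of_isUnit_mem _ h1 ?_)
  exact (Ne.isUnit hcon).map MvPolynomial.C

/-- The action of the torus on the weighted polynomial ring. -/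
noncomputable def torusAction (w : Fin (n + 1) → ℕ) (t : k) :
    MvPolynomial (Fin (n + 1)) k →ₐ[k] MvPolynomial (Fin (n + 1)) k :=
  MvPolynomial.aeval fun i => MvPolynomial.C (t ^ w i) * MvPolynomial.X i

theorem torusAction_of_mem_grading (t : k) {d : ℕ} {f : MvPolynomial (Fin (n + 1)) k}
    (hf : f ∈ grading k w d) : torusAction w t f = MvPolynomial.C (t ^ d) * f := by
  conv_lhs => rw [f.as_sum]
  conv_rhs => rw [f.as_sum]
  rw [map_sum, Finset.mul_sum]
  refine Finset.sum_congr rfl fun m hm => ?_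
  have hd : Finsupp.weight w m = d := hf (MvPolynomial.mem_support_iff.mp hm)
  rw [torusAction, MvPolynomial.aeval_monomial, MvPolynomial.monomial_eq, ← hd,
    Finsupp.weight_apply]
  simp only [mul_pow, MvPolynomial.algebraMap_eq, Finsupp.sum, Finsupp.prod,
    ← map_pow, ← pow_mul, smul_eq_mul, mul_comm (w _)]
  rw [Finset.prod_mul_distrib, ← map_prod, Finset.prod_pow_eq_pow_sum]
  ring

theorem torusAction_mem {I : Ideal (MvPolynomial (Fin (n + 1)) k)}
    (hI : I.IsHomogeneous (grading k w)) (t : k) {f : MvPolynomial (Fin (n + 1)) k} (hf : f ∈ I) :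
    torusAction w t f ∈ I := by
  classical
  rw [← DirectSum.sum_support_decompose (grading k w) f, map_sum]
  refine I.sum_mem fun d _ => ?_
  rw [torusAction_of_mem_grading t (SetLike.coe_mem _)]
  exact I.mul_mem_left _ (hI d hf)

theorem torusAction_comp {t s : k} (h : t * s = 1) :
    (torusAction w t).comp (torusAction w s) = AlgHom.id k _ := by
  ext i : 1
  simp only [torusAction, AlgHom.comp_apply, MvPolynomial.aeval_X, map_mul, MvPolynomial.aeval_C,
    AlgHom.id_apply, MvPolynomial.algebraMap_eq]
  rw [← mul_assoc, ← map_mul, ← mul_pow, mul_comm s t, h, one_pow, map_one, one_mul]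

/-- The automorphism of the weighted polynomial ring given by a point of the torus. -/
noncomputable def torusEquiv (w : Fin (n + 1) → ℕ) (t : k) (ht : t ≠ 0) :
    MvPolynomial (Fin (n + 1)) k ≃ₐ[k] MvPolynomial (Fin (n + 1)) k :=
  AlgEquiv.ofAlgHom (torusAction w t) (torusAction w t⁻¹)
    (torusAction_comp (mul_inv_cancel₀ ht)) (torusAction_comp (inv_mul_cancel₀ ht))

theorem map_torusEquiv {I : Ideal (MvPolynomial (Fin (n + 1)) k)}
    (hI : I.IsHomogeneous (grading k w)) {t : k} (ht : t ≠ 0) :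
    I.map (torusEquiv w t ht) = I := by
  apply le_antisymm
  · rw [Ideal.map_le_iff_le_comap]
    exact fun f hf => torusAction_mem hI t hf
  · intro f hf
    rw [← (torusEquiv w t ht).apply_symm_apply f]
    exact Ideal.mem_map_of_mem _ (torusAction_mem hI t⁻¹ hf)

variable [IsAlgClosed k]

theorem exists_torusEquiv_notMem (hw : ∀ i, 0 < w i) {F : MvPolynomial (Fin (n + 1)) k}
    (hF : F ∉ MvPolynomial.idealOfVars (Fin (n + 1)) k)
    (𝔫 : Ideal (MvPolynomial (Fin (n + 1)) k)) [h𝔫 : 𝔫.IsMaximal] :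
    ∃ (t : k) (ht : t ≠ 0), torusEquiv w t ht F ∉ 𝔫 := by
  obtain ⟨x, hx⟩ := MvPolynomial.isMaximal_iff_eq_vanishingIdeal_singleton.mp h𝔫
  -- `G` is `F` along the orbit `t ↦ (t^(w i) x_i)` of the closed point `x`. Its value at `0` is
  -- `F(0) ≠ 0`, so `G ≠ 0`; the later factor `X` makes the chosen `t` nonzero.
  let G : Polynomial k := MvPolynomial.aeval
    (fun i => Polynomial.C (x i) * Polynomial.X ^ w i) F
  have hG0 : G.eval 0 = MvPolynomial.constantCoeff F := by
    have : (Polynomial.evalRingHom 0).comp (MvPolynomial.aeval (R := k)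
        fun i => Polynomial.C (x i) * Polynomial.X ^ w i).toRingHom =
        MvPolynomial.constantCoeff := by
      ext i
      · simp
      · simp [(hw i).ne']
    exact DFunLike.congr_fun this F
  have hG : ∀ t, G.eval t = MvPolynomial.aeval x (torusAction w t F) := by
    intro t
    have : (Polynomial.aeval t).comp (MvPolynomial.aeval
        (fun i => Polynomial.C (x i) * Polynomial.X ^ w i)) =
        (MvPolynomial.aeval x).comp (torusAction w t) := by
      ext i
      simp [torusAction]
      ring
    exact DFunLike.congr_fun this F
  have hGX : G * Polynomial.X ≠ 0 := by
    refine mul_ne_zero (fun h => hF ?_) Polynomial.X_ne_zero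
    rw [mem_idealOfVars_iff_constantCoeff_eq_zero, ← hG0, h, Polynomial.eval_zero]
  obtain ⟨t, ht⟩ : ∃ t, (G * Polynomial.X).eval t ≠ 0 := by
    by_contra! hcon
    exact hGX (Polynomial.funext fun t => by rw [hcon, Polynomial.eval_zero])
  rw [Polynomial.eval_mul, Polynomial.eval_X, hG] at ht
  refine ⟨t, right_ne_zero_of_mul ht, fun h => ?_⟩
  rw [hx, MvPolynomial.mem_vanishingIdeal_singleton_iff] at h
  exact left_ne_zero_of_mul ht h

end Torus

/-! ### Comparing depth, dimension and height -/

section DepthAndDimension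

theorem depth_le_of_ringEquiv {R R' : Type*} [CommRing R] [CommRing R'] (e : R ≃+* R') :
    depth R ≤ depth R' := by
  refine iSup_le fun rs => ?_
  have h : RingTheory.Sequence.IsRegular R' (rs.1.map e) := by
    refine (AddEquiv.isRegular_congr (e := e.toAddEquiv) ?_).mp rs.2
    rw [List.forall₂_map_right_iff, List.forall₂_same]
    intro x _ y
    simp
  have h1 : ((rs.1.map e).length : ℕ∞) ≤ depth R' :=
    le_iSup (fun rs : {rs : List R' // RingTheory.Sequence.IsRegular R' rs} =>
      (rs.1.length : ℕ∞)) ⟨_, h⟩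
  rwa [List.length_map] at h1

theorem depth_le_ringKrullDim {R : Type*} [CommRing R] [IsNoetherianRing R] [IsLocalRing R] :
    (depth R : WithBot ℕ∞) ≤ ringKrullDim R := by
  have h : ∀ rs : {rs : List R // RingTheory.Sequence.IsRegular R rs},
      ((rs.1.length : ℕ∞) : WithBot ℕ∞) ≤ ringKrullDim R := by
    intro rs
    rw [← ringKrullDim_add_length_eq_ringKrullDim_of_isRegular rs.1 rs.2]
    have : Nontrivial (R ⧸ Ideal.ofList rs.1) := by
      rw [Ideal.Quotient.nontrivial_iff]
      have := rs.2.top_ne_smul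
      rw [smul_eq_mul, Ideal.mul_top] at this
      exact this.symm
    exact le_add_of_nonneg_left ringKrullDim_nonneg_of_nontrivial
  obtain ⟨d, hd⟩ := WithBot.ne_bot_iff_exists.mp (ringKrullDim_ne_bot (R := R))
  rw [← hd] at h ⊢
  exact WithBot.coe_le_coe.mpr (iSup_le fun rs => WithBot.coe_le_coe.mp (h rs))

theorem DepthGE.le_depth_quotient {R : Type u} [CommRing R] [IsLocalRing R] [IsNoetherianRing R]
    {d : ℕ} {J : Ideal R} (h : DepthGE R d (R ⧸ J)) (hJ : J ≠ ⊤) : (d : ℕ∞) ≤ depth (R ⧸ J) := by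
  obtain ⟨rs, hl, hm, hw⟩ := h.exists_isWeaklyRegular
  have : Nontrivial (R ⧸ J) := Ideal.Quotient.nontrivial_iff.mpr hJ
  have hw' := (RingTheory.Sequence.isWeaklyRegular_map_algebraMap_iff (R ⧸ J) (R ⧸ J) rs).mpr hw
  have hreg : RingTheory.Sequence.IsRegular (R ⧸ J) (rs.map (algebraMap R (R ⧸ J))) := by
    refine ⟨hw', ?_⟩
    have h1 := ((IsLocalRing.isRegular_iff_isWeaklyRegular_of_subset_maximalIdeal hm).mpr
      hw).top_ne_smul
    intro h2
    apply h1
    ext x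
    simp only [Submodule.mem_top, true_iff]
    have hx : x ∈ Ideal.ofList (rs.map (algebraMap R (R ⧸ J))) • (⊤ : Submodule (R ⧸ J) (R ⧸ J)) :=
      h2 ▸ Submodule.mem_top
    rw [smul_eq_mul, Ideal.mul_top, ← Ideal.map_ofList] at hx
    rw [Ideal.smul_top_eq_map]
    exact hx
  have h3 := le_iSup (fun rs : {rs : List (R ⧸ J) // RingTheory.Sequence.IsRegular (R ⧸ J) rs} =>
      (rs.1.length : ℕ∞)) ⟨_, hreg⟩
  rwa [List.length_map, hl] at h3

/-- A chain in `S/I` contracts to a strict chain in `S` that starts at height at least `c`. -/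
theorem height_le_of_forall_le_height {S : Type*} [CommRing S] {I : Ideal S} {c N : ℕ}
    (hI : ∀ P : Ideal S, P.IsPrime → I ≤ P → (c : ℕ∞) ≤ P.height)
    (𝔭 : Ideal (S ⧸ I)) [h𝔭 : 𝔭.IsPrime] (hN : (𝔭.comap (Ideal.Quotient.mk I)).height ≤ N) :
    𝔭.height ≤ ((N - c : ℕ) : ℕ∞) := by
  have h1 := PrimeSpectrum.height_eq_orderHeight (⟨𝔭, h𝔭⟩ : PrimeSpectrum (S ⧸ I))
  rw [show 𝔭.height = _ from h1]
  refine Order.height_le fun l hl => ?_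
  have h2 : ∀ i : Fin (l.length + 1), ((i : ℕ) : ℕ∞) + c ≤
      ((l i).asIdeal.comap (Ideal.Quotient.mk I)).height := by
    intro i
    induction i using Fin.induction with
    | zero =>
      rw [Fin.val_zero, Nat.cast_zero, zero_add]
      refine hI _ (Ideal.comap_isPrime _ _) fun x hx => ?_
      rw [Ideal.mem_comap, Ideal.Quotient.eq_zero_iff_mem.mpr hx]
      exact zero_mem _
    | succ i ih =>
      have hlt : (l i.castSucc).asIdeal < (l i.succ).asIdeal := l.step i
      have hlt' : (l i.castSucc).asIdeal.comap (Ideal.Quotient.mk I) <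
          (l i.succ).asIdeal.comap (Ideal.Quotient.mk I) :=
        lt_of_le_of_ne (Ideal.comap_mono hlt.le) fun h =>
          hlt.ne (Ideal.comap_injective_of_surjective _ Ideal.Quotient.mk_surjective h)
      have := Ideal.height_add_one_le_of_lt_of_isPrime hlt'
      refine le_trans ?_ this
      rw [Fin.val_succ, Nat.cast_add, Nat.cast_one, add_right_comm]
      exact add_le_add_left ih 1
  have h3 := h2 (Fin.last _)
  rw [show l (Fin.last _) = _ from hl, Fin.val_last] at h3
  replace h3 := h3.trans hN
  have h4 : l.length + c ≤ N := by exact_mod_cast h3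
  have h5 : l.length ≤ N - c := by omega
  exact_mod_cast h5

/-- A minimal prime `P` of `J` is associated to `R/J`, so `dim R/P ≥ d - e`, which leaves at most
`e` for its height. -/
theorem DepthGE.exists_isPrime_height_le {R : Type u} [CommRing R] [IsLocalRing R]
    [IsNoetherianRing R] {d e : ℕ} {J : Ideal R} (hdim : ringKrullDim R ≤ d)
    (h : DepthGE R (d - e) (R ⧸ J)) (hJ : J ≠ ⊤) (he : e ≤ d) :
    ∃ P : Ideal R, P.IsPrime ∧ J ≤ P ∧ P.height ≤ e := by
  obtain ⟨P, hP⟩ := Ideal.nonempty_minimalPrimes hJ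
  have hPp : P.IsPrime := hP.1.1
  refine ⟨P, hPp, hP.1.2, ?_⟩
  have h1 : IsAssociatedPrime P (R ⧸ J) :=
    Module.associatedPrimes.minimalPrimes_annihilator_subset_associatedPrimes R (R ⧸ J)
      (by rwa [Ideal.annihilator_quotient])
  have h2 := h.le_coheight (P := ⟨P, hPp⟩) h1
  have h6 : P.height + ((d - e : ℕ) : ℕ∞) ≤ (d : ℕ∞) :=
    (add_le_add_right h2 _).trans (height_add_coheight_le hdim ⟨P, hPp⟩)
  have htop : P.height ≠ ⊤ := Ideal.height_ne_top hPp.ne_top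
  generalize P.height = x at *
  lift x to ℕ using htop
  norm_cast at *
  omega

end DepthAndDimension

/-! ### Height and depth for the homogeneous ideal of minors -/

section Global

variable {k : Type u} [Field k] {n p q : ℕ} {w : Fin (n + 1) → ℕ}
  {M : Matrix (Fin p) (Fin q) (MvPolynomial (Fin (n + 1)) k)}

theorem IsPseudoOneGeneric.mem_idealOfVars (hM : IsPseudoOneGeneric M) (i : Fin p) (j : Fin q) :
    M i j ∈ MvPolynomial.idealOfVars (Fin (n + 1)) k := by
  classical
  have h1 := hM (Pi.single i 1) (by simp)
  have h2 := height_add_length_le (𝔪 := MvPolynomial.idealOfVars (Fin (n + 1)) k)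
    (List.ofFn (generalizedRow M (Pi.single i 1))) (by rwa [List.map_ofFn])
  refine h2.1 (Ideal.subset_span ?_)
  refine (List.mem_ofFn' _ _).mpr ⟨j, ?_⟩
  rw [generalizedRow, Finset.sum_eq_single i]
  · simp
  · intro b _ hb
    simp [hb]
  · simp

theorem IsPseudoOneGeneric.maximalMinors_le_idealOfVars (hM : IsPseudoOneGeneric M) (hp : 1 ≤ p) :
    maximalMinors M ≤ MvPolynomial.idealOfVars (Fin (n + 1)) k := by
  rw [maximalMinors, Ideal.span_le]
  rintro _ ⟨f, rfl⟩
  have : Nonempty (Fin p) := ⟨⟨0, hp⟩⟩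
  rw [SetLike.mem_coe, mem_idealOfVars_iff_constantCoeff_eq_zero, RingHom.map_det]
  convert Matrix.det_zero (n := Fin p) (R := k)
  ext i j
  exact (mem_idealOfVars_iff_constantCoeff_eq_zero _).mp (hM.mem_idealOfVars i (f j))

variable [IsAlgClosed k]

theorem IsPseudoOneGeneric.le_add_one (hM : IsPseudoOneGeneric M) (hp : 1 ≤ p) : q ≤ n + 1 := by
  classical
  have h1 := hM (Pi.single ⟨0, hp⟩ 1) (by simp)
  have h2 := (height_add_length_le (𝔪 := MvPolynomial.idealOfVars (Fin (n + 1)) k)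
    (List.ofFn (generalizedRow M (Pi.single ⟨0, hp⟩ 1))) (by rwa [List.map_ofFn])).2
  rw [height_eq_card_of_isMaximal, List.length_ofFn, Fintype.card_fin] at h2
  exact_mod_cast (le_add_self (a := (q : ℕ∞))).trans h2.le

/-- A torus element moves the closed point to one where `F` does not vanish. As the torus preserves
the ideal, the two local rings of the quotient are isomorphic. -/
theorem depth_localization_quotient_maximalMinors (hw : ∀ i, 0 < w i) (hpq : p ≤ q)
    (hI : (maximalMinors M).IsHomogeneous (grading k w)) (hM : IsPseudoOneGeneric M)
    (𝔐 : Ideal (MvPolynomial (Fin (n + 1)) k ⧸ maximalMinors M)) [h𝔐 : 𝔐.IsMaximal] :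
    ((n + 1 - (q + 1 - p) : ℕ) : ℕ∞) ≤ depth (Localization.AtPrime 𝔐) := by
  obtain ⟨F, hF𝔪, hF⟩ := exists_notMem_idealOfVars_forall_le_height hM
  have h𝔫 : (𝔐.comap (Ideal.Quotient.mk (maximalMinors M))).IsMaximal :=
    Ideal.comap_isMaximal_of_surjective _ Ideal.Quotient.mk_surjective
  obtain ⟨t, ht, hFt⟩ := exists_torusEquiv_notMem hw hF𝔪
    (𝔐.comap (Ideal.Quotient.mk (maximalMinors M)))
  let φ : MvPolynomial (Fin (n + 1)) k ≃+* MvPolynomial (Fin (n + 1)) k :=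
    (torusEquiv w t ht).toRingEquiv
  have hφI : (maximalMinors M).map (φ : MvPolynomial (Fin (n + 1)) k →+* _) = maximalMinors M :=
    map_torusEquiv hI ht
  let h : MvPolynomial (Fin (n + 1)) k ⧸ maximalMinors M ≃+*
      MvPolynomial (Fin (n + 1)) k ⧸ maximalMinors M :=
    Ideal.quotientEquiv _ _ φ hφI.symm
  have hh : ∀ x, h (Ideal.Quotient.mk _ x) = Ideal.Quotient.mk _ (φ x) := fun x => rfl
  let 𝔫' := (𝔐.comap (Ideal.Quotient.mk (maximalMinors M))).comap
    (φ : MvPolynomial (Fin (n + 1)) k →+* _)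
  have h𝔫' : 𝔫'.IsMaximal := Ideal.comap_isMaximal_of_surjective _ φ.surjective
  have hI𝔫' : maximalMinors M ≤ 𝔫' := by
    intro x hx
    have hφx : φ x ∈ maximalMinors M := hφI.le (Ideal.mem_map_of_mem _ hx)
    change Ideal.Quotient.mk _ (φ x) ∈ 𝔐
    rw [Ideal.Quotient.eq_zero_iff_mem.mpr hφx]
    exact zero_mem _
  have h1 := depthGE_quotient_map_maximalMinors hpq hF 𝔫' hFt
  have h2 := h1.le_depth_quotient fun htop => by
    have h3 := (Ideal.map_mono hI𝔫').trans_eq' htop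
    rw [Localization.AtPrime.map_eq_maximalIdeal] at h3
    exact (maximalIdeal.isMaximal (Localization.AtPrime 𝔫')).ne_top (top_le_iff.mp h3)
  have hp' : (𝔫'.map (Ideal.Quotient.mk (maximalMinors M))).IsPrime :=
    Ideal.isPrime_map_quotientMk_of_isPrime hI𝔫'
  have := isLocalizationAtPrime_quotient hI𝔫'
  have hmap : Submonoid.map h.toMonoidHom
      (𝔫'.map (Ideal.Quotient.mk (maximalMinors M))).primeCompl = 𝔐.primeCompl := by
    have hiff : ∀ x, x ∈ 𝔫'.map (Ideal.Quotient.mk (maximalMinors M)) ↔ h x ∈ 𝔐 := by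
      intro x
      obtain ⟨x, rfl⟩ := Ideal.Quotient.mk_surjective x
      rw [← Ideal.mem_comap, Ideal.comap_map_of_surjective _ Ideal.Quotient.mk_surjective,
        ← RingHom.ker_eq_comap_bot, Ideal.mk_ker, sup_eq_left.mpr hI𝔫', hh]
      rfl
    ext y
    constructor
    · rintro ⟨x, hx, rfl⟩
      exact fun hy => hx ((hiff x).mpr hy)
    · intro hy
      refine ⟨h.symm y, fun hx => hy ?_, h.apply_symm_apply y⟩
      rw [← h.apply_symm_apply y]
      exact (hiff _).mp hx
  exact h2.trans (depth_le_of_ringEquiv (IsLocalization.ringEquivOfRingEquiv _ _ h hmap))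

theorem le_height_of_maximalMinors_le (hw : ∀ i, 0 < w i)
    (hI : (maximalMinors M).IsHomogeneous (grading k w)) (hM : IsPseudoOneGeneric M)
    {P : Ideal (MvPolynomial (Fin (n + 1)) k)} [P.IsPrime] (hP : maximalMinors M ≤ P) :
    ((q + 1 - p : ℕ) : ℕ∞) ≤ P.height := by
  obtain ⟨Q, hQ, hQP⟩ := Ideal.exists_minimalPrimes_le hP
  have hQp : Q.IsPrime := hQ.1.1
  refine le_trans ?_ (Ideal.height_mono hQP)
  refine le_height_of_leadingMinors_le hM le_rfl le_rfl
    (le_idealOfVars_of_isHomogeneous hw (isHomogeneous_of_mem_minimalPrimes hI hQ) hQp.ne_top) ?_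
  rw [leadingMinors_extendByZero]
  exact hQ.1.2

theorem exists_isHomogeneous_height_eq (hw : ∀ i, 0 < w i) (hp : 1 ≤ p) (hpq : p ≤ q)
    (hI : (maximalMinors M).IsHomogeneous (grading k w)) (hM : IsPseudoOneGeneric M) :
    ∃ P : Ideal (MvPolynomial (Fin (n + 1)) k), P.IsPrime ∧ P.IsHomogeneous (grading k w) ∧
      maximalMinors M ≤ P ∧ P.height = ((q + 1 - p : ℕ) : ℕ∞) := by
  obtain ⟨F, hF𝔪, hF⟩ := exists_notMem_idealOfVars_forall_le_height hM
  have h1 := depthGE_quotient_map_maximalMinors hpq hF _ hF𝔪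
  have hdim : ringKrullDim (LocalRingAtOrigin k n) ≤ ((n + 1 : ℕ) : ℕ) := by
    rw [IsLocalization.AtPrime.ringKrullDim_eq_height (MvPolynomial.idealOfVars (Fin (n + 1)) k),
      height_eq_card_of_isMaximal, Fintype.card_fin]
    exact le_rfl
  have hq := hM.le_add_one hp
  obtain ⟨P', hP', hIP', hht⟩ := h1.exists_isPrime_height_le hdim (fun htop => by
    have h3 := (Ideal.map_mono (hM.maximalMinors_le_idealOfVars hp)).trans_eq' htop
    rw [Localization.AtPrime.map_eq_maximalIdeal] at h3
    exact (maximalIdeal.isMaximal (LocalRingAtOrigin k n)).ne_top (top_le_iff.mp h3)) (by omega)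
  have hPp : (P'.under (MvPolynomial (Fin (n + 1)) k)).IsPrime := Ideal.comap_isPrime _ _
  rw [← IsLocalization.height_under (MvPolynomial.idealOfVars (Fin (n + 1)) k).primeCompl] at hht
  -- The prime found at the origin need not be homogeneous; a minimal prime below it is, and the
  -- lower bound fixes its height.
  obtain ⟨Q, hQ, hQP⟩ := Ideal.exists_minimalPrimes_le (Ideal.map_le_iff_le_comap.mp hIP')
  have hQp : Q.IsPrime := hQ.1.1
  exact ⟨Q, hQp, isHomogeneous_of_mem_minimalPrimes hI hQ, hQ.1.2,
    le_antisymm ((Ideal.height_mono hQP).trans hht) (le_height_of_maximalMinors_le hw hI hM hQ.1.2)⟩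

theorem height_maximalMinors (hw : ∀ i, 0 < w i) (hp : 1 ≤ p) (hpq : p ≤ q)
    (hI : (maximalMinors M).IsHomogeneous (grading k w)) (hM : IsPseudoOneGeneric M) :
    (maximalMinors M).height = ((q + 1 - p : ℕ) : ℕ∞) := by
  apply le_antisymm
  · obtain ⟨P, -, -, hle, hht⟩ := exists_isHomogeneous_height_eq hw hp hpq hI hM
    exact (Ideal.height_mono hle).trans hht.le
  · rw [Ideal.height_eq_inf_minimalPrimes]
    refine le_iInf₂ fun P hP => ?_
    have hPp : P.IsPrime := hP.1.1
    exact le_height_of_maximalMinors_le hw hI hM hP.1.2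

theorem isCohenMacaulayRing_quotient_maximalMinors (hw : ∀ i, 0 < w i) (hpq : p ≤ q)
    (hI : (maximalMinors M).IsHomogeneous (grading k w)) (hM : IsPseudoOneGeneric M) :
    IsCohenMacaulayRing (MvPolynomial (Fin (n + 1)) k ⧸ maximalMinors M) where
  isNoetherianRing := inferInstance
  depth_eq_dim 𝔐 h𝔐 := by
    refine le_antisymm depth_le_ringKrullDim ?_
    rw [IsLocalization.AtPrime.ringKrullDim_eq_height 𝔐]
    refine WithBot.coe_le_coe.mpr (le_trans ?_
      (depth_localization_quotient_maximalMinors hw hpq hI hM 𝔐))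
    have h𝔫 : (𝔐.comap (Ideal.Quotient.mk (maximalMinors M))).IsMaximal :=
      Ideal.comap_isMaximal_of_surjective _ Ideal.Quotient.mk_surjective
    refine height_le_of_forall_le_height
      (fun P _ hP => le_height_of_maximalMinors_le hw hI hM hP) 𝔐 ?_
    rw [height_eq_card_of_isMaximal, Fintype.card_fin]

end Global

/-! ### Codimension in `Proj` and height -/

section ProjectiveSpectrum

variable {A σ : Type*} [CommRing A] [SetLike σ A] [AddSubgroupClass σ A] {𝒜 : ℕ → σ}
  [GradedRing 𝒜]

/-- In a projective spectrum the irreducible closed subsets correspond to the points. -/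
noncomputable def closureOrderIso :
    (ProjectiveSpectrum 𝒜)ᵒᵈ ≃o TopologicalSpace.IrreducibleCloseds (ProjectiveSpectrum 𝒜) := by
  let f : ProjectiveSpectrum 𝒜 → TopologicalSpace.IrreducibleCloseds (ProjectiveSpectrum 𝒜) :=
    fun x => ⟨closure {x}, isIrreducible_singleton.closure, isClosed_closure⟩
  have hf : ∀ x y, f x ≤ f y ↔ y ≤ x := by
    intro x y
    rw [ProjectiveSpectrum.le_iff_mem_closure]
    exact isClosed_closure.closure_subset_iff.trans Set.singleton_subset_iff
  refine RelIso.ofSurjective (OrderEmbedding.ofMapLEIff (fun x => f (OrderDual.ofDual x))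
    fun x y => hf _ _) ?_
  have hsober : QuasiSober (ProjectiveSpectrum 𝒜) :=
    inferInstanceAs (QuasiSober (AlgebraicGeometry.Proj 𝒜))
  intro Y
  obtain ⟨x, hx⟩ := QuasiSober.sober Y.isIrreducible' Y.isClosed'
  exact ⟨OrderDual.toDual x, TopologicalSpace.IrreducibleCloseds.ext hx⟩

theorem codim_zeroLocus (s : Set A) : codim (ProjectiveSpectrum.zeroLocus 𝒜 s) =
    ⨅ x ∈ ProjectiveSpectrum.zeroLocus 𝒜 s, Order.height x := by
  have hsub : ∀ x : (ProjectiveSpectrum 𝒜)ᵒᵈ, (closureOrderIso x : Set (ProjectiveSpectrum 𝒜)) ⊆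
      ProjectiveSpectrum.zeroLocus 𝒜 s ↔ OrderDual.ofDual x ∈ ProjectiveSpectrum.zeroLocus 𝒜 s :=
    fun x => (ProjectiveSpectrum.isClosed_zeroLocus 𝒜 s).closure_subset_iff.trans
      Set.singleton_subset_iff
  have hht : ∀ x : (ProjectiveSpectrum 𝒜)ᵒᵈ, Order.coheight (closureOrderIso x) =
      Order.height (OrderDual.ofDual x) := fun x => Order.coheight_orderIso _ _
  apply le_antisymm
  · refine le_iInf₂ fun x hx => ?_
    refine le_of_le_of_eq ?_ (hht (OrderDual.toDual x))
    exact iInf₂_le (closureOrderIso (OrderDual.toDual x)) ((hsub (OrderDual.toDual x)).mpr hx)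
  · refine le_iInf₂ fun Y hY => ?_
    obtain ⟨x, rfl⟩ := closureOrderIso.surjective Y
    rw [hht]
    exact iInf₂_le _ ((hsub x).mp hY)

theorem exists_homogeneous_mem_notMem {P Q : Ideal A} (hP : P.IsHomogeneous 𝒜)
    (h : ¬ P ≤ Q) : ∃ f ∈ P, f ∉ Q ∧ ∃ d, f ∈ 𝒜 d := by
  classical
  obtain ⟨g, hgP, hgQ⟩ := SetLike.not_le_iff_exists.mp h
  by_contra! hcon
  apply hgQ
  rw [← DirectSum.sum_support_decompose 𝒜 g]
  refine Q.sum_mem fun d _ => ?_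
  by_contra hd
  exact hcon _ (hP d hgP) hd d (SetLike.coe_mem _)

variable [IsNoetherianRing A]

/-- Makes a chain of primes homogeneous from the bottom. Choose a homogeneous `f` in `P` outside
`Q`, reroute the chain so that its second member contains `f`, and replace `Q` by a minimal prime of
`Q + (f)` below that member; it is homogeneous and strictly larger than `Q`. -/
theorem height_add_length_le_height (m : ℕ) (P Q : ProjectiveSpectrum 𝒜)
    (s : LTSeries (PrimeSpectrum A)) (hs : s.length = m)
    (hhead : Q.asHomogeneousIdeal.toIdeal ≤ s.head.asIdeal)
    (hlast : s.last.asIdeal = P.asHomogeneousIdeal.toIdeal) :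
    Order.height Q + m ≤ Order.height P := by
  induction m generalizing Q s with
  | zero =>
    rw [Nat.cast_zero, add_zero]
    refine Order.height_mono ?_
    have : s.head = s.last := congrArg s (Fin.ext (by simp [hs]))
    rw [this, hlast] at hhead
    exact hhead
  | succ m ih =>
    have hlt : s.head < s.last := s.strictMono (by
      rw [Fin.lt_def, Fin.val_last, Fin.val_zero]; omega)
    have hPQ : ¬ P.asHomogeneousIdeal.toIdeal ≤ Q.asHomogeneousIdeal.toIdeal := fun h => by
      rw [← hlast] at h
      exact not_le_of_gt hlt (h.trans hhead)
    obtain ⟨f, hfP, hfQ, d, hfd⟩ := exists_homogeneous_mem_notMem P.asHomogeneousIdeal.isHomogeneous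
      hPQ
    obtain ⟨t, hft, hlen, hhead', hlast'⟩ :=
      PrimeSpectrum.exist_ltSeries_mem_one_of_mem_last s (x := f) (hlast ▸ hfP)
    have htl : t.length ≠ 0 := by omega
    have hQt : Q.asHomogeneousIdeal.toIdeal ⊔ Ideal.span {f} ≤ (t 1).asIdeal := by
      refine sup_le (hhead.trans ?_) ((Ideal.span_singleton_le_iff_mem _).mpr hft)
      rw [hhead']
      exact t.strictMono.monotone (Fin.zero_le _)
    obtain ⟨Q₁, hQ₁, hQ₁t⟩ := Ideal.exists_minimalPrimes_le hQt
    have htP : (t 1).asIdeal ≤ P.asHomogeneousIdeal.toIdeal := by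
      rw [← hlast, hlast']
      exact t.strictMono.monotone (Fin.le_last _)
    have hhom : Q₁.IsHomogeneous 𝒜 := by
      refine isHomogeneous_of_mem_minimalPrimes (Ideal.IsHomogeneous.sup
        Q.asHomogeneousIdeal.isHomogeneous (Ideal.homogeneous_span _ _ ?_)) hQ₁
      rintro x rfl
      exact ⟨d, hfd⟩
    let Q' : ProjectiveSpectrum 𝒜 := ⟨⟨Q₁, hhom⟩, hQ₁.1.1, fun h =>
      P.not_irrelevant_le (h.trans (hQ₁t.trans htP))⟩
    have h1 := ih Q' (t.tail htl) (by rw [RelSeries.tail_length]; omega)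
      (by rw [RelSeries.head_tail]; exact hQ₁t) (by rw [RelSeries.last_tail, ← hlast', hlast])
    have h2 : Q < Q' := by
      refine lt_of_le_not_ge (show Q.asHomogeneousIdeal.toIdeal ≤ Q₁ from
        le_sup_left.trans hQ₁.1.2) fun h => hfQ ?_
      exact (show Q₁ ≤ Q.asHomogeneousIdeal.toIdeal from h)
        (hQ₁.1.2 (Ideal.mem_sup_right (Ideal.mem_span_singleton_self f)))
    refine le_trans ?_ h1
    rw [Nat.cast_add, Nat.cast_one, add_comm (m : ℕ∞), ← add_assoc]
    exact add_le_add_left (Order.height_add_one_le h2) _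

theorem height_projectiveSpectrum (P : ProjectiveSpectrum 𝒜) :
    Order.height P = P.asHomogeneousIdeal.toIdeal.height := by
  rw [show P.asHomogeneousIdeal.toIdeal.height = Order.height
    (⟨_, P.isPrime⟩ : PrimeSpectrum A) from PrimeSpectrum.height_eq_orderHeight ⟨_, P.isPrime⟩]
  apply le_antisymm
  · refine Order.height_le_height_apply_of_strictMono
      (fun x : ProjectiveSpectrum 𝒜 => (⟨_, x.isPrime⟩ : PrimeSpectrum A)) ?_ P
    exact fun x y hxy => hxy
  · refine Order.height_le fun s hs => ?_
    have hlast : s.last.asIdeal = P.asHomogeneousIdeal.toIdeal := by rw [hs]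
    have hle : (s.head.asIdeal.homogeneousCore 𝒜).toIdeal ≤ s.head.asIdeal :=
      Ideal.toIdeal_homogeneousCore_le 𝒜 _
    -- The homogeneous core of the first prime of the chain starts the homogeneous chain.
    let Q : ProjectiveSpectrum 𝒜 := ⟨s.head.asIdeal.homogeneousCore 𝒜,
      s.head.isPrime.homogeneousCore, fun h => P.not_irrelevant_le (h.trans (hle.trans
        ((show s.head.asIdeal ≤ s.last.asIdeal from s.head_le_last).trans hlast.le)))⟩
    exact le_add_self.trans (height_add_length_le_height s.length P Q s rfl hle hlast)

end ProjectiveSpectrum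

/-! ### The locus of the minors in weighted projective space -/

section WeightedProjectiveSpace

variable {k : Type u} [Field k] {n : ℕ} {w : Fin (n + 1) → ℕ}

theorem irrelevant_toIdeal (hw : ∀ i, 0 < w i) :
    (HomogeneousIdeal.irrelevant (grading k w)).toIdeal =
      MvPolynomial.idealOfVars (Fin (n + 1)) k := by
  apply le_antisymm
  · refine le_idealOfVars_of_isHomogeneous hw (HomogeneousIdeal.isHomogeneous _) fun h => ?_
    have h1 : (1 : MvPolynomial (Fin (n + 1)) k) ∈ HomogeneousIdeal.irrelevant (grading k w) := by
      rw [← HomogeneousIdeal.mem_iff, h]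
      trivial
    rw [HomogeneousIdeal.mem_irrelevant_iff, GradedRing.proj_apply,
      DirectSum.decompose_of_mem_same _ SetLike.GradedOne.one_mem] at h1
    exact one_ne_zero h1
  · rw [MvPolynomial.idealOfVars, Ideal.span_le]
    rintro _ ⟨i, rfl⟩
    rw [SetLike.mem_coe, HomogeneousIdeal.mem_iff, HomogeneousIdeal.mem_irrelevant_iff,
      GradedRing.proj_apply]
    exact DirectSum.decompose_of_mem_ne _ (MvPolynomial.isWeightedHomogeneous_X k w i) (hw i).ne'

end WeightedProjectiveSpace

section VanishingLocus

variable {k : Type u} [Field k] [IsAlgClosed k] {n p q : ℕ} {w : Fin (n + 1) → ℕ}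
  {M : Matrix (Fin p) (Fin q) (MvPolynomial (Fin (n + 1)) k)}

theorem codim_vanishingLocus_maximalMinors (hw : ∀ i, 0 < w i) (hp : 1 ≤ p) (hpq : p ≤ q)
    (hI : (maximalMinors M).IsHomogeneous (grading k w)) (hM : IsPseudoOneGeneric M)
    (hn : q + 1 - p ≤ n) :
    codim (vanishingLocus k w (maximalMinors M)) = ((q + 1 - p : ℕ) : ℕ∞) := by
  refine (codim_zeroLocus _).trans (le_antisymm ?_ (le_iInf₂ fun x hx => ?_))
  · obtain ⟨P, hP, hhom, hle, hht⟩ := exists_isHomogeneous_height_eq hw hp hpq hI hM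
    let x : ProjectiveSpectrum (grading k w) := ⟨⟨P, hhom⟩, hP, fun h => by
      have h1 : MvPolynomial.idealOfVars (Fin (n + 1)) k ≤ P := (irrelevant_toIdeal hw).ge.trans h
      have h2 := Ideal.height_mono h1
      rw [height_eq_card_of_isMaximal, hht, Fintype.card_fin] at h2
      have : n + 1 ≤ q + 1 - p := by exact_mod_cast h2
      omega⟩
    refine (iInf₂_le x hle).trans ?_
    rw [height_projectiveSpectrum]
    exact hht.le
  · rw [height_projectiveSpectrum]
    exact le_height_of_maximalMinors_le hw hI hM hx

theorem vanishingLocus_maximalMinors_eq_empty (hw : ∀ i, 0 < w i)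
    (hI : (maximalMinors M).IsHomogeneous (grading k w)) (hM : IsPseudoOneGeneric M)
    (hn : n < q + 1 - p) : vanishingLocus k w (maximalMinors M) = ∅ := by
  refine Set.eq_empty_of_forall_notMem fun (x : ProjectiveSpectrum (grading k w)) hx => ?_
  -- A relevant homogeneous prime lies strictly below `𝔪`, so its height is at most `n`.
  have h1 : x.asHomogeneousIdeal.toIdeal < MvPolynomial.idealOfVars (Fin (n + 1)) k := by
    refine lt_of_le_not_ge (le_idealOfVars_of_isHomogeneous hw
      x.asHomogeneousIdeal.isHomogeneous x.isPrime.ne_top) fun h => x.not_irrelevant_le ?_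
    exact (irrelevant_toIdeal hw).le.trans h
  have h2 := Ideal.height_add_one_le_of_lt_of_isPrime h1
  have h3 : ((q + 1 - p : ℕ) : ℕ∞) ≤ x.asHomogeneousIdeal.toIdeal.height :=
    le_height_of_maximalMinors_le hw hI hM hx
  rw [height_eq_card_of_isMaximal (MvPolynomial.idealOfVars _ _), Fintype.card_fin] at h2
  have h4 : (q + 1 - p) + 1 ≤ n + 1 := by exact_mod_cast (add_le_add_left h3 1).trans h2
  omega

end VanishingLocus

end WeightedDet

theorem mainTheorem9 {k : Type*} [Field k] [IsAlgClosed k] {n : ℕ}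
    (w : Fin (n + 1) → ℕ) (hw : ∀ i, 0 < w i)
    {p q : ℕ} (hp : 1 ≤ p) (hpq : p ≤ q)
    (M : Matrix (Fin p) (Fin q) (MvPolynomial (Fin (n + 1)) k))
    (hI : (WeightedDet.maximalMinors M).IsHomogeneous (WeightedDet.grading k w))
    (hM : WeightedDet.IsPseudoOneGeneric M) :
    -- the coordinate ring of `X = V(I_p(M))` is Cohen–Macaulay
    WeightedDet.IsCohenMacaulayRing
        (MvPolynomial (Fin (n + 1)) k ⧸ WeightedDet.maximalMinors M) ∧
      -- `I_p(M)`, the ideal of the affine cone over `X`, has codimension `q - p + 1`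
      (WeightedDet.maximalMinors M).height = ((q - p + 1 : ℕ) : ℕ∞) ∧
      -- `X` has codimension `q - p + 1` in the `n`-dimensional space `P(w)`;
      -- for `q - p + 1 = n + 1` this means that `X` is empty
      (q - p + 1 ≤ n →
        WeightedDet.codim (WeightedDet.vanishingLocus k w (WeightedDet.maximalMinors M)) =
          ((q - p + 1 : ℕ) : ℕ∞)) ∧
      (n < q - p + 1 →
        WeightedDet.vanishingLocus k w (WeightedDet.maximalMinors M) = ∅) := by
  rw [← Nat.sub_add_comm hpq]
  exact ⟨WeightedDet.isCohenMacaulayRing_quotient_maximalMinors hw hpq hI hM,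
    WeightedDet.height_maximalMinors hw hp hpq hI hM,
    WeightedDet.codim_vanishingLocus_maximalMinors hw hp hpq hI hM,
    WeightedDet.vanishingLocus_maximalMinors_eq_empty hw hI hM⟩
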